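/- Let $a_1=(\sqrt3,0)$ and $a_2=\tfrac12(\sqrt3,3)$. Let $\Gamma=\Gamma_A\cup\Gamma_B\subset\mathbb R^2$ be the hexagonal lattice, where $\Gamma_A=\mathbb Z a_1+\mathbb Z a_2$ consists of the sites $A_{j,k}=ja_1+ka_2$ and $\Gamma_B=\Gamma_A+(0,1)$ consists of the sites $B_{j,k}=ja_1+ka_2+(0,1)$. Two sites are joined by an edge if they are nearest neighbours (at Euclidean distance $1$), and $|x-y|$ denotes the length of a shortest path from $x$ to $y$ in this graph. Let $\mathcal H=\ell^2(\Gamma)\otimes\mathbb C^3$ with orthonormal basis $x^{(i)}=|x\rangle\otimes e_i$, $x\in\Gamma$, $i\in\{1,2,3\}$. The shift operator $S$ is given by $S\,x^{(i)}=(\sigma_i x)^{(i)}$, where $$\sigma_1A_{j,k}=B_{j,k-1},\quad \sigma_1B_{j,k}=A_{j-1,k+1},\qquad \sigma_2A_{j,k}=B_{j+1,k-1},\quad \sigma_2B_{j,k}=A_{j,k},\qquad \sigma_3A_{j,k}=B_{j,k},\quad \sigma_3B_{j,k}=A_{j,k+1}.$$ For $C\in U(3)$ let $\mathcal C(C)(|x\rangle\otimes\tau)=|x\rangle\otimes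 C\tau$. Let $(\omega_x)_{x\in\Gamma}$ be i.i.d. random variables, uniformly distributed on $[0,2\pi)$, one per lattice site, let $D_\omega(|x\rangle\otimes\tau)=e^{i\omega_x}|x\rangle\otimes\tau$, and let $$U_\omega(C)=D_\omega\,S\,\mathcal C(C).$$ Let $C_0=\begin{pmatrix}0&1&0\\0&0&1\\1&0&0\end{pmatrix}$ and let $\|M\|_\infty$ be the largest absolute value of an entry of the matrix $M$. **Theorem.** For every $s\in(0,\tfrac13)$ there exist $\varphi,c,g>0$, depending only on $s$, such that for every $C\in U(3)$ with $\|C-C_0\|_\infty\le\varphi$, every $z\in\mathbb C$ with $|z|<1$, all sites $x,y\in\Gamma$ and all $i,j\in\{1,2,3\}$: the operator $U_\omega(C)-z$ is invertible in $\mathcal B(\mathcal H)$ for every realisation of the phases, the random variable $|\langle x^{(i)}|(U_\omega(C)-z)^{-1}y^{(j)}\rangle|^s$ is integrable, and $$\mathbb E\Big(\big|\langle x^{(i)}\,|\,(U_\omega(C)-z)^{-1}\,y^{(j)}\rangle\big|^s\Big)\le c\,e^{-g|x-y|}.$$ -/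

import Mathlib

open MeasureTheory ProbabilityTheory
open scoped ENNReal

namespace HexWalk

/-- The sites of the hexagonal lattice. With `a₁ = (√3, 0)` and `a₂ = (√3, 3) / 2`, the site
`A j k` is the point `j a₁ + k a₂` of the triangular lattice `Γ_A`, and the site `B j k` is the
point `j a₁ + k a₂ + (0, 1)` of `Γ_B = Γ_A + (0, 1)`. -/
inductive Site : Type
  | A (j k : ℤ) : Site
  | B (j k : ℤ) : Site
  deriving DecidableEq

/-- The three nearest neighbour moves of the lattice; `hop i` is the bijection of sites underlying
the shift operator with coin index `i` (the coin indices 1, 2, 3 are written 0, 1, 2). -/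
def hop : Fin 3 → Site → Site
  | 0, .A j k => .B j (k - 1)
  | 0, .B j k => .A (j - 1) (k + 1)
  | 1, .A j k => .B (j + 1) (k - 1)
  | 1, .B j k => .A j k
  | 2, .A j k => .B j k
  | 2, .B j k => .A j (k + 1)

/-- The inverse of `hop i`. -/
def hopInv : Fin 3 → Site → Site
  | 0, .A j k => .B (j + 1) (k - 1)
  | 0, .B j k => .A j (k + 1)
  | 1, .A j k => .B j k
  | 1, .B j k => .A (j - 1) (k + 1)
  | 2, .A j k => .B j (k - 1)
  | 2, .B j k => .A j k

theorem hopInv_hop (i : Fin 3) (x : Site) : hopInv i (hop i x) = x := by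
  fin_cases i <;> cases x <;> simp [hop, hopInv]

theorem hop_hopInv (i : Fin 3) (x : Site) : hop i (hopInv i x) = x := by
  fin_cases i <;> cases x <;> simp [hop, hopInv]

theorem exists_hop_hop (i : Fin 3) (x : Site) : ∃ i', x = hop i' (hop i x) := by
  fin_cases i <;> cases x
  · exact ⟨2, by simp [hop]⟩
  · exact ⟨1, by simp [hop]⟩
  · exact ⟨0, by simp [hop]⟩
  · exact ⟨2, by simp [hop]⟩
  · exact ⟨1, by simp [hop]⟩
  · exact ⟨0, by simp [hop]⟩

theorem hop_ne (i : Fin 3) (x : Site) : x ≠ hop i x := by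
  fin_cases i <;> cases x <;> simp [hop]

/-- The hexagonal lattice as a graph: two sites are adjacent if they are nearest neighbours, i.e.
if they lie at Euclidean distance 1 from each other. -/
def graph : SimpleGraph Site where
  Adj x y := ∃ i, y = hop i x
  symm := ⟨by rintro x y ⟨i, rfl⟩; exact exists_hop_hop i x⟩
  loopless := ⟨by rintro x ⟨i, hi⟩; exact hop_ne i x hi⟩

/-- The Hilbert space `ℓ²(Γ) ⊗ ℂ³`, realised as `ℓ²(Γ × {1, 2, 3})`. -/
abbrev H : Type := lp (fun _ : Site × Fin 3 => ℂ) 2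

/-- The basis vector `x^(i) = |x⟩ ⊗ e_i`. -/
noncomputable def ket (x : Site) (i : Fin 3) : H := lp.single 2 (x, i) (1 : ℂ)

theorem sum_sq_le (ψ : H) (s : Finset (Site × Fin 3)) :
    ∑ p ∈ s, ‖ψ p‖ ^ (2 : ℝ≥0∞).toReal ≤ ‖ψ‖ ^ (2 : ℝ≥0∞).toReal :=
  lp.sum_rpow_le_norm_rpow (by norm_num) ψ s

/-- A linear endomorphism of functions on `Γ × {1, 2, 3}` which is bounded for the `ℓ²` norm,
as a bounded operator on `H`. -/
noncomputable def mkOp (T : (Site × Fin 3 → ℂ) →ₗ[ℂ] (Site × Fin 3 → ℂ)) (K : ℝ) (hK : 0 ≤ K)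
    (hT : ∀ (ψ : H) (s : Finset (Site × Fin 3)),
      ∑ p ∈ s, ‖T ψ p‖ ^ (2 : ℝ≥0∞).toReal ≤ (K * ‖ψ‖) ^ (2 : ℝ≥0∞).toReal) : H →L[ℂ] H :=
  LinearMap.mkContinuous
    { toFun := fun ψ => ⟨T ψ, memℓp_gen' (hT ψ)⟩
      map_add' := fun ψ χ => by
        apply lp.ext
        exact T.map_add ψ χ
      map_smul' := fun a ψ => by
        apply lp.ext
        exact T.map_smul a ψ } K
    (fun ψ => lp.norm_le_of_forall_sum_le (by norm_num) (by positivity) (hT ψ))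

/-- The shift operator `S = ∑ᵢ Sᵢ ⊗ |e_i⟩⟨e_i|`, which maps `x^(i)` to `(hop i x)^(i)`. -/
noncomputable def shiftOp : H →L[ℂ] H :=
  mkOp
    { toFun := fun ψ p => ψ (hopInv p.2 p.1, p.2)
      map_add' := fun _ _ => rfl
      map_smul' := fun _ _ => rfl } 1 zero_le_one (by
    intro ψ s
    rw [one_mul]
    have hinj : Function.Injective
        (fun p : Site × Fin 3 => ((hopInv p.2 p.1, p.2) : Site × Fin 3)) := by
      rintro ⟨x, i⟩ ⟨y, j⟩ h
      simp only [Prod.mk.injEq] at h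
      obtain ⟨h1, rfl⟩ := h
      rw [← hop_hopInv i x, h1, hop_hopInv]
    refine le_trans (le_of_eq ?_) (sum_sq_le ψ (s.map ⟨_, hinj⟩))
    rw [Finset.sum_map]
    rfl)

/-- The coin operator `𝒞(C)`, which maps `|x⟩ ⊗ τ` to `|x⟩ ⊗ C τ` at every site `x`. -/
noncomputable def coinOp (C : Matrix (Fin 3) (Fin 3) ℂ) : H →L[ℂ] H :=
  mkOp
    { toFun := fun ψ p => ∑ j, C p.2 j * ψ (p.1, j)
      map_add' := fun ψ χ => by
        funext p
        simp [mul_add, Finset.sum_add_distrib]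
      map_smul' := fun a ψ => by
        funext p
        simp [Finset.mul_sum, mul_left_comm] } (∑ i, ∑ j, ‖C i j‖) (by positivity) (by
    intro ψ s
    have h2 : (2 : ℝ≥0∞).toReal = ((2 : ℕ) : ℝ) := by norm_num
    have key := fun t => sum_sq_le ψ t
    simp only [h2, Real.rpow_natCast] at key ⊢
    set K : ℝ := ∑ i, ∑ j, ‖C i j‖ with hK
    have hrow : ∀ i, ∑ j, ‖C i j‖ ^ 2 ≤ (∑ j, ‖C i j‖) ^ 2 := fun i =>
      Finset.sum_sq_le_sq_sum_of_nonneg fun j _ => norm_nonneg _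
    have hK2 : ∑ i, ∑ j, ‖C i j‖ ^ 2 ≤ K ^ 2 :=
      (Finset.sum_le_sum fun i _ => hrow i).trans
        (Finset.sum_sq_le_sq_sum_of_nonneg fun i _ => Finset.sum_nonneg fun j _ => norm_nonneg _)
    have hpt : ∀ p : Site × Fin 3, ‖∑ j, C p.2 j * ψ (p.1, j)‖ ^ 2
        ≤ (∑ j, ‖C p.2 j‖ ^ 2) * ∑ j, ‖ψ (p.1, j)‖ ^ 2 := by
      intro p
      calc ‖∑ j, C p.2 j * ψ (p.1, j)‖ ^ 2
          ≤ (∑ j, ‖C p.2 j‖ * ‖ψ (p.1, j)‖) ^ 2 := by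
            gcongr
            exact (norm_sum_le _ _).trans (le_of_eq (by simp only [norm_mul]))
        _ ≤ _ := Finset.sum_mul_sq_le_sq_mul_sq _ _ _
    calc ∑ p ∈ s, ‖∑ j, C p.2 j * ψ (p.1, j)‖ ^ 2
        ≤ ∑ p ∈ s, (∑ j, ‖C p.2 j‖ ^ 2) * ∑ j, ‖ψ (p.1, j)‖ ^ 2 :=
          Finset.sum_le_sum fun p _ => hpt p
      _ ≤ ∑ p ∈ s.image Prod.fst ×ˢ (Finset.univ : Finset (Fin 3)),
            (∑ j, ‖C p.2 j‖ ^ 2) * ∑ j, ‖ψ (p.1, j)‖ ^ 2 := by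
          refine Finset.sum_le_sum_of_subset_of_nonneg ?_ fun _ _ _ => by positivity
          intro p hp
          simp only [Finset.mem_product, Finset.mem_univ, and_true]
          exact Finset.mem_image_of_mem _ hp
      _ = (∑ i, ∑ j, ‖C i j‖ ^ 2) *
            ∑ p ∈ s.image Prod.fst ×ˢ (Finset.univ : Finset (Fin 3)), ‖ψ p‖ ^ 2 := by
          simp only [Finset.sum_product]
          rw [Finset.mul_sum]
          refine Finset.sum_congr rfl fun x _ => ?_
          rw [Finset.sum_mul]
      _ ≤ K ^ 2 * ‖ψ‖ ^ 2 := by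
          gcongr
          exact key _
      _ = (K * ‖ψ‖) ^ 2 := by ring)

/-- The phase operator `D_θ`, which maps `|x⟩ ⊗ τ` to `e^{i θ_x} |x⟩ ⊗ τ`. There is a single phase
per lattice site, shared by the three coin states. -/
noncomputable def phaseOp (θ : Site → ℝ) : H →L[ℂ] H :=
  mkOp
    { toFun := fun ψ p => Complex.exp (Complex.I * (θ p.1 : ℂ)) * ψ p
      map_add' := fun ψ χ => by
        funext p
        simp [mul_add]
      map_smul' := fun a ψ => by
        funext p
        simp [mul_left_comm] } 1 zero_le_one (by
    intro ψ s
    have h1 : ∀ p : Site × Fin 3,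
        ‖Complex.exp (Complex.I * (θ p.1 : ℂ)) * ψ p‖ = ‖ψ p‖ := by
      intro p
      rw [norm_mul, mul_comm Complex.I, Complex.norm_exp_ofReal_mul_I, one_mul]
    simp only [LinearMap.coe_mk, AddHom.coe_mk, h1, one_mul]
    exact sum_sq_le ψ s)

/-- The quantum walk `U_θ(C) = D_θ S 𝒞(C)` with coin matrix `C` and phases `θ`. -/
noncomputable def walk (θ : Site → ℝ) (C : Matrix (Fin 3) (Fin 3) ℂ) : H →L[ℂ] H :=
  phaseOp θ * shiftOp * coinOp C

/-- The permutation matrix `C₀`. -/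
def C₀ : Matrix (Fin 3) (Fin 3) ℂ := !![0, 1, 0; 0, 0, 1; 1, 0, 0]

/-- The norm `‖M‖_∞`: the largest absolute value of an entry of `M`. -/
noncomputable def maxNorm (M : Matrix (Fin 3) (Fin 3) ℂ) : ℝ := ⨆ p : Fin 3 × Fin 3, ‖M p.1 p.2‖

/-- The Green function `⟨x^(i) | (U_θ(C) - z)⁻¹ y^(j)⟩`. -/
noncomputable def green (θ : Site → ℝ) (C : Matrix (Fin 3) (Fin 3) ℂ) (z : ℂ)
    (x : Site) (i : Fin 3) (y : Site) (j : Fin 3) : ℂ :=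
  inner ℂ (ket x i) (Ring.inverse (walk θ C - z • (1 : H →L[ℂ] H)) (ket y j))

end HexWalk

namespace HexWalk

/-! Factor U - z = D (S𝒞(C) - z D⁻¹). Up to a unimodular factor the Green function is `res C z d p
q`, an entry of (S𝒞(C) - z d)⁻¹ with d the inverse phases. Here d may be any weight of modulus at
most one, so a single weight can be varied or set to zero, and the resolvent depends on it through a
3×3 system (1 - wB)γ = ρ.

For C = C₀ the walk runs along closed orbits of length six, each around a star whose centre is
visited three times. For C near C₀, one turn around an orbit far from the source gives (1 - ζw³) ·
res = O(φ) · (nearby entries), where w is the weight at the centre and ζ does not depend on it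
(`norm_one_sub_mul_norm_res_le`, `exists_center`). The small divisor is correlated with the nearby
entries. They are separated by averaging over w alone: everything is a quotient of polynomials in w
of bounded degree, and negative moments of such polynomials on the circle are controlled by their
size on the disc (`exists_lintegral_eval_rpow_neg_le`). This gives `exists_lintegral_decouple_le`;
the determinant times 1 - ζw³ has degree at most six, hence the restriction r < 1/6.

The outcome, `exists_lintegral_res_le_sum`, bounds the r-th moment by φʳ times a sum of 18 moments
nearby. Its iteration starts from the a priori bound `exists_lintegral_res_le`, which holds up to
order 1/3 because the determinant has degree at most three and because blocks with removed weights
are bounded (`norm_res_le_one`). For small φ the r-th moments decay exponentially; interpolation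
with a bounded moment of order between s and 1/3 gives the decay for every s < 1/3. -/

/-! ### Coordinates, and unitarity of the walk without phases -/

theorem shiftOp_apply (ψ : H) (p : Site × Fin 3) : shiftOp ψ p = ψ (hopInv p.2 p.1, p.2) := rfl

theorem coinOp_apply (C : Matrix (Fin 3) (Fin 3) ℂ) (ψ : H) (p : Site × Fin 3) :
    coinOp C ψ p = ∑ j, C p.2 j * ψ (p.1, j) := rfl

theorem phaseOp_apply (θ : Site → ℝ) (ψ : H) (p : Site × Fin 3) :
    phaseOp θ ψ p = Complex.exp (Complex.I * (θ p.1 : ℂ)) * ψ p := rfl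

theorem ket_apply (x : Site) (i : Fin 3) (p : Site × Fin 3) :
    ket x i p = if p = (x, i) then 1 else 0 := by
  simp [ket, lp.single_apply, Pi.single_apply]

theorem norm_ket (x : Site) (i : Fin 3) : ‖ket x i‖ = 1 := by
  simp [ket, lp.norm_single]

theorem inner_ket (x : Site) (i : Fin 3) (ψ : H) : inner ℂ (ket x i) ψ = ψ (x, i) := by
  rw [ket, lp.inner_single_left]
  simp

theorem sum_norm_sq_le (ψ : H) (s : Finset (Site × Fin 3)) : ∑ p ∈ s, ‖ψ p‖ ^ 2 ≤ ‖ψ‖ ^ 2 := by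
  have := sum_sq_le ψ s
  simpa using this

theorem hasSum_norm_sq (ψ : H) : HasSum (fun p => ‖ψ p‖ ^ 2) (‖ψ‖ ^ 2) := by
  have := lp.hasSum_norm (p := 2) (by norm_num) ψ
  simpa using this

theorem norm_le_of_sum_sq_le {ψ : H} {K : ℝ} (hK : 0 ≤ K)
    (h : ∀ s : Finset (Site × Fin 3), ∑ p ∈ s, ‖ψ p‖ ^ 2 ≤ K ^ 2) : ‖ψ‖ ≤ K := by
  refine lp.norm_le_of_forall_sum_le (by norm_num) hK fun s => ?_
  simpa using h s

theorem sum_norm_sq_mulVec {C : Matrix (Fin 3) (Fin 3) ℂ} (hC : C ∈ Matrix.unitaryGroup (Fin 3) ℂ)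
    (v : Fin 3 → ℂ) : ∑ i, ‖∑ j, C i j * v j‖ ^ 2 = ∑ i, ‖v i‖ ^ 2 := by
  have key : ∀ w : Fin 3 → ℂ, ((∑ i, ‖w i‖ ^ 2 : ℝ) : ℂ) = star w ⬝ᵥ w := by
    intro w
    simp only [dotProduct, Pi.star_apply, RCLike.star_def, Complex.conj_mul', Complex.ofReal_sum,
      Complex.ofReal_pow]
  have h : star (C.mulVec v) ⬝ᵥ C.mulVec v = star v ⬝ᵥ v := by
    rw [Matrix.star_mulVec, ← Matrix.dotProduct_mulVec, Matrix.mulVec_mulVec,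
      ← Matrix.star_eq_conjTranspose, Matrix.mem_unitaryGroup_iff'.1 hC, Matrix.one_mulVec]
  rw [← key, ← key] at h
  exact_mod_cast h

theorem norm_coinOp_apply_le {C : Matrix (Fin 3) (Fin 3) ℂ}
    (hC : C ∈ Matrix.unitaryGroup (Fin 3) ℂ) (ψ : H) : ‖coinOp C ψ‖ ≤ ‖ψ‖ := by
  refine norm_le_of_sum_sq_le (norm_nonneg _) fun s => ?_
  -- Unitarity of `C` conserves only the sum over all three coin states, so `s` is enlarged to whole
  -- fibres.
  calc ∑ p ∈ s, ‖coinOp C ψ p‖ ^ 2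
      ≤ ∑ p ∈ s.image Prod.fst ×ˢ (Finset.univ : Finset (Fin 3)), ‖coinOp C ψ p‖ ^ 2 := by
        refine Finset.sum_le_sum_of_subset_of_nonneg ?_ fun _ _ _ => by positivity
        intro p hp
        simp only [Finset.mem_product, Finset.mem_univ, and_true]
        exact Finset.mem_image_of_mem _ hp
    _ = ∑ p ∈ s.image Prod.fst ×ˢ (Finset.univ : Finset (Fin 3)), ‖ψ p‖ ^ 2 := by
        simp only [Finset.sum_product, coinOp_apply]
        exact Finset.sum_congr rfl fun x _ => sum_norm_sq_mulVec hC fun j => ψ (x, j)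
    _ ≤ ‖ψ‖ ^ 2 := sum_norm_sq_le ψ _

theorem coinOp_mul (C D : Matrix (Fin 3) (Fin 3) ℂ) : coinOp C * coinOp D = coinOp (C * D) := by
  ext ψ p
  rw [mul_apply_eq_comp]
  simp only [coinOp_apply, Matrix.mul_apply, Fin.sum_univ_three]
  ring

theorem coinOp_one : coinOp 1 = 1 := by
  ext ψ p
  simp [coinOp_apply, Matrix.one_apply]

/-- The inverse of the shift operator. -/
noncomputable def shiftInvOp : H →L[ℂ] H :=
  mkOp
    { toFun := fun ψ p => ψ (hop p.2 p.1, p.2)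
      map_add' := fun _ _ => rfl
      map_smul' := fun _ _ => rfl } 1 zero_le_one (by
    intro ψ s
    rw [one_mul]
    have hinj : Function.Injective
        (fun p : Site × Fin 3 => ((hop p.2 p.1, p.2) : Site × Fin 3)) := by
      rintro ⟨x, i⟩ ⟨y, j⟩ h
      simp only [Prod.mk.injEq] at h
      obtain ⟨h1, rfl⟩ := h
      rw [← hopInv_hop i x, h1, hopInv_hop]
    refine le_trans (le_of_eq ?_) (sum_sq_le ψ (s.map ⟨_, hinj⟩))
    rw [Finset.sum_map]
    rfl)

theorem shiftInvOp_apply (ψ : H) (p : Site × Fin 3) :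
    shiftInvOp ψ p = ψ (hop p.2 p.1, p.2) := rfl

theorem shiftOp_mul_shiftInvOp : shiftOp * shiftInvOp = 1 := by
  ext ψ p
  simp [shiftOp_apply, shiftInvOp_apply, hop_hopInv]

theorem shiftInvOp_mul_shiftOp : shiftInvOp * shiftOp = 1 := by
  ext ψ p
  simp [shiftOp_apply, shiftInvOp_apply, hopInv_hop]

theorem norm_mkOp_apply_le (T : (Site × Fin 3 → ℂ) →ₗ[ℂ] (Site × Fin 3 → ℂ)) (K : ℝ) (hK : 0 ≤ K)
    (hT : ∀ (ψ : H) (s : Finset (Site × Fin 3)),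
      ∑ p ∈ s, ‖T ψ p‖ ^ (2 : ℝ≥0∞).toReal ≤ (K * ‖ψ‖) ^ (2 : ℝ≥0∞).toReal)
    (ψ : H) : ‖mkOp T K hK hT ψ‖ ≤ K * ‖ψ‖ :=
  lp.norm_le_of_forall_sum_le (by norm_num) (by positivity) (hT ψ)

theorem norm_shiftOp_apply_le (ψ : H) : ‖shiftOp ψ‖ ≤ ‖ψ‖ :=
  (norm_mkOp_apply_le _ _ _ _ ψ).trans (one_mul _).le

/-- The walk without phases. -/
noncomputable def freeOp (C : Matrix (Fin 3) (Fin 3) ℂ) : H →L[ℂ] H := shiftOp * coinOp C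

/-- The inverse of `freeOp C` for unitary `C`. -/
noncomputable def freeInvOp (C : Matrix (Fin 3) (Fin 3) ℂ) : H →L[ℂ] H :=
  coinOp (star C) * shiftInvOp

theorem freeOp_mul_freeInvOp {C : Matrix (Fin 3) (Fin 3) ℂ}
    (hC : C ∈ Matrix.unitaryGroup (Fin 3) ℂ) : freeOp C * freeInvOp C = 1 := by
  rw [freeOp, freeInvOp, mul_assoc, ← mul_assoc (coinOp C), coinOp_mul,
    Matrix.mem_unitaryGroup_iff.1 hC, coinOp_one, one_mul, shiftOp_mul_shiftInvOp]

theorem freeInvOp_mul_freeOp {C : Matrix (Fin 3) (Fin 3) ℂ}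
    (hC : C ∈ Matrix.unitaryGroup (Fin 3) ℂ) : freeInvOp C * freeOp C = 1 := by
  rw [freeOp, freeInvOp, mul_assoc, ← mul_assoc shiftInvOp, shiftInvOp_mul_shiftOp, one_mul,
    coinOp_mul, Matrix.mem_unitaryGroup_iff'.1 hC, coinOp_one]

theorem norm_freeInvOp_apply_le {C : Matrix (Fin 3) (Fin 3) ℂ}
    (hC : C ∈ Matrix.unitaryGroup (Fin 3) ℂ) (ψ : H) : ‖freeInvOp C ψ‖ ≤ ‖ψ‖ :=
  (norm_coinOp_apply_le (Unitary.star_mem hC) _).trans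
    ((norm_mkOp_apply_le _ _ _ _ ψ).trans (one_mul _).le)

theorem norm_freeOp_apply {C : Matrix (Fin 3) (Fin 3) ℂ}
    (hC : C ∈ Matrix.unitaryGroup (Fin 3) ℂ) (ψ : H) : ‖freeOp C ψ‖ = ‖ψ‖ := by
  refine le_antisymm ((norm_shiftOp_apply_le _).trans (norm_coinOp_apply_le hC ψ)) ?_
  have h := norm_freeInvOp_apply_le hC (freeOp C ψ)
  rwa [← mul_apply_eq_comp, freeInvOp_mul_freeOp hC,
    one_apply_eq_self] at h

theorem freeOp_apply (C : Matrix (Fin 3) (Fin 3) ℂ) (ψ : H) (x : Site) (i : Fin 3) :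
    freeOp C ψ (x, i) = ∑ j, C i j * ψ (hopInv i x, j) := rfl

/-! ### Moving the phases into a weight: S𝒞(C) - z d -/

/-- The value of a weight, cut off to `0` outside the closed unit disc. -/
noncomputable def cut (w : ℂ) : ℂ := if ‖w‖ ≤ 1 then w else 0

theorem norm_cut_le (w : ℂ) : ‖cut w‖ ≤ 1 := by
  unfold cut
  split_ifs with h
  · exact h
  · simp

theorem cut_of_le {w : ℂ} (h : ‖w‖ ≤ 1) : cut w = w := if_pos h

theorem measurable_cut : Measurable cut :=
  Measurable.ite (measurableSet_le measurable_norm measurable_const) measurable_id measurable_const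

/-- Multiplication by the weight `d x` (cut off to the unit disc) at every site `x`. -/
noncomputable def weightOp (d : Site → ℂ) : H →L[ℂ] H :=
  mkOp
    { toFun := fun ψ p => cut (d p.1) * ψ p
      map_add' := fun ψ χ => by
        funext p
        simp [mul_add]
      map_smul' := fun a ψ => by
        funext p
        simp [mul_left_comm] } 1 zero_le_one (by
    intro ψ s
    rw [one_mul]
    refine le_trans (Finset.sum_le_sum fun p _ => ?_) (sum_sq_le ψ s)
    refine Real.rpow_le_rpow (norm_nonneg _) ?_ (by norm_num)
    simp only [LinearMap.coe_mk, AddHom.coe_mk, norm_mul]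
    exact mul_le_of_le_one_left (norm_nonneg _) (norm_cut_le _))

theorem weightOp_apply (d : Site → ℂ) (ψ : H) (p : Site × Fin 3) :
    weightOp d ψ p = cut (d p.1) * ψ p := rfl

theorem norm_weightOp_apply_le (d : Site → ℂ) (ψ : H) : ‖weightOp d ψ‖ ≤ ‖ψ‖ :=
  (norm_mkOp_apply_le _ _ _ _ ψ).trans (one_mul _).le

/-- The operator `S 𝒞(C) - z d`, where `d` acts by multiplication. -/
noncomputable def weightedOp (C : Matrix (Fin 3) (Fin 3) ℂ) (z : ℂ) (d : Site → ℂ) : H →L[ℂ] H :=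
  freeOp C - z • weightOp d

theorem norm_smul_freeInvOp_mul_weightOp {C : Matrix (Fin 3) (Fin 3) ℂ}
    (hC : C ∈ Matrix.unitaryGroup (Fin 3) ℂ) {z : ℂ} (hz : ‖z‖ < 1) (d : Site → ℂ) :
    ‖z • (freeInvOp C * weightOp d)‖ < 1 := by
  refine lt_of_le_of_lt ?_ hz
  rw [norm_smul]
  refine mul_le_of_le_one_right (norm_nonneg _) (ContinuousLinearMap.opNorm_le_bound _ zero_le_one
    fun ψ => ?_)
  rw [one_mul]
  exact (norm_freeInvOp_apply_le hC _).trans (norm_weightOp_apply_le d ψ)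

/-- The second factor is inverted by a Neumann series, as its perturbation has norm at most |z|. The
weight itself need not be invertible, so weights may be removed. -/
theorem weightedOp_eq {C : Matrix (Fin 3) (Fin 3) ℂ}
    (hC : C ∈ Matrix.unitaryGroup (Fin 3) ℂ) (z : ℂ) (d : Site → ℂ) :
    weightedOp C z d = freeOp C * (1 - z • (freeInvOp C * weightOp d)) := by
  rw [mul_sub, mul_one, mul_smul_comm, ← mul_assoc, freeOp_mul_freeInvOp hC, one_mul, weightedOp]

theorem isUnit_freeOp {C : Matrix (Fin 3) (Fin 3) ℂ}
    (hC : C ∈ Matrix.unitaryGroup (Fin 3) ℂ) : IsUnit (freeOp C) :=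
  ⟨⟨freeOp C, freeInvOp C, freeOp_mul_freeInvOp hC, freeInvOp_mul_freeOp hC⟩, rfl⟩

theorem isUnit_weightedOp {C : Matrix (Fin 3) (Fin 3) ℂ}
    (hC : C ∈ Matrix.unitaryGroup (Fin 3) ℂ) {z : ℂ} (hz : ‖z‖ < 1) (d : Site → ℂ) :
    IsUnit (weightedOp C z d) := by
  rw [weightedOp_eq hC]
  exact (isUnit_freeOp hC).mul
    (isUnit_one_sub_of_norm_lt_one (norm_smul_freeInvOp_mul_weightOp hC hz d))

/-- The matrix elements of the inverse of `S 𝒞(C) - z d`. -/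
noncomputable def res (C : Matrix (Fin 3) (Fin 3) ℂ) (z : ℂ) (d : Site → ℂ)
    (p q : Site × Fin 3) : ℂ :=
  Ring.inverse (weightedOp C z d) (ket q.1 q.2) p

/-- The inverse phases `e^{-iθ}`. -/
noncomputable def phases (θ : Site → ℝ) : Site → ℂ := fun x => Complex.exp (-(θ x : ℂ) * Complex.I)

theorem norm_phases (θ : Site → ℝ) (x : Site) : ‖phases θ x‖ = 1 := by
  rw [phases, ← Complex.ofReal_neg, Complex.norm_exp_ofReal_mul_I]

theorem exp_mul_phases (θ : Site → ℝ) (x : Site) :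
    Complex.exp (Complex.I * (θ x : ℂ)) * phases θ x = 1 := by
  rw [phases, ← Complex.exp_add]
  ring_nf
  exact Complex.exp_zero

theorem phaseOp_mul_weightOp (θ : Site → ℝ) : phaseOp θ * weightOp (phases θ) = 1 := by
  ext ψ p
  rw [mul_apply_eq_comp, phaseOp_apply, weightOp_apply,
    cut_of_le (norm_phases θ p.1).le, ← mul_assoc, exp_mul_phases, one_mul]
  rfl

theorem weightOp_mul_phaseOp (θ : Site → ℝ) : weightOp (phases θ) * phaseOp θ = 1 := by
  ext ψ p
  rw [mul_apply_eq_comp, weightOp_apply, phaseOp_apply,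
    cut_of_le (norm_phases θ p.1).le, ← mul_assoc, mul_comm (phases θ p.1), exp_mul_phases, one_mul]
  rfl

theorem isUnit_phaseOp (θ : Site → ℝ) : IsUnit (phaseOp θ) :=
  ⟨⟨phaseOp θ, weightOp (phases θ), phaseOp_mul_weightOp θ, weightOp_mul_phaseOp θ⟩, rfl⟩

theorem walk_sub_eq (θ : Site → ℝ) (C : Matrix (Fin 3) (Fin 3) ℂ) (z : ℂ) :
    walk θ C - z • (1 : H →L[ℂ] H) = phaseOp θ * weightedOp C z (phases θ) := by
  rw [weightedOp, mul_sub, mul_smul_comm, phaseOp_mul_weightOp, walk, freeOp, mul_assoc]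

theorem isUnit_walk_sub (θ : Site → ℝ) {C : Matrix (Fin 3) (Fin 3) ℂ}
    (hC : C ∈ Matrix.unitaryGroup (Fin 3) ℂ) {z : ℂ} (hz : ‖z‖ < 1) :
    IsUnit (walk θ C - z • (1 : H →L[ℂ] H)) := by
  rw [walk_sub_eq]
  exact (isUnit_phaseOp θ).mul (isUnit_weightedOp hC hz _)

/-- The leftover factor D⁻¹ acts on a basis vector as a unimodular scalar. -/
theorem norm_green (θ : Site → ℝ) {C : Matrix (Fin 3) (Fin 3) ℂ}
    (hC : C ∈ Matrix.unitaryGroup (Fin 3) ℂ) {z : ℂ} (hz : ‖z‖ < 1) (x : Site) (i : Fin 3)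
    (y : Site) (j : Fin 3) : ‖green θ C z x i y j‖ = ‖res C z (phases θ) (x, i) (y, j)‖ := by
  obtain ⟨u, hu⟩ := isUnit_weightedOp hC hz (phases θ)
  have hv : Ring.inverse (walk θ C - z • (1 : H →L[ℂ] H))
      = Ring.inverse (weightedOp C z (phases θ)) * weightOp (phases θ) := by
    rw [walk_sub_eq]
    have h1 : phaseOp θ * weightedOp C z (phases θ) =
      ((⟨phaseOp θ, weightOp (phases θ), phaseOp_mul_weightOp θ, weightOp_mul_phaseOp θ⟩ *
        u : (H →L[ℂ] H)ˣ) : H →L[ℂ] H) := by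
      rw [Units.val_mul, hu]
    rw [h1, Ring.inverse_unit, ← hu, Ring.inverse_unit, mul_inv_rev, Units.val_mul]
    rfl
  have hk : weightOp (phases θ) (ket y j) = phases θ y • ket y j := by
    ext p
    rw [weightOp_apply, cut_of_le (norm_phases θ p.1).le, lp.coeFn_smul, Pi.smul_apply, smul_eq_mul,
      ket_apply]
    split_ifs with h
    · rw [h]
    · simp
  rw [green, hv, inner_ket, mul_apply_eq_comp, hk, map_smul, lp.coeFn_smul,
    Pi.smul_apply, norm_smul, norm_phases, one_mul, res]

/-! ### Resolvent equation, bound without weights, resolvent identity, measurability -/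

section Resolvent

variable {C : Matrix (Fin 3) (Fin 3) ℂ} {z : ℂ}

theorem weightedOp_inverse_apply (hC : C ∈ Matrix.unitaryGroup (Fin 3) ℂ) (hz : ‖z‖ < 1)
    (d : Site → ℂ) (ψ : H) : weightedOp C z d (Ring.inverse (weightedOp C z d) ψ) = ψ := by
  rw [← mul_apply_eq_comp, Ring.mul_inverse_cancel _ (isUnit_weightedOp hC hz d)]
  rfl

/-- The defining equation of a column of the resolvent. -/
theorem sum_coin_mul_res (hC : C ∈ Matrix.unitaryGroup (Fin 3) ℂ) (hz : ‖z‖ < 1)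
    {d : Site → ℂ} (hd : ∀ x, ‖d x‖ ≤ 1) (x : Site) (i : Fin 3) (q : Site × Fin 3) :
    ∑ j, C i j * res C z d (hopInv i x, j) q
      = z * d x * res C z d (x, i) q + if (x, i) = q then 1 else 0 := by
  have h := congrArg (fun ψ : H => ψ (x, i)) (weightedOp_inverse_apply hC hz d (ket q.1 q.2))
  simp only [weightedOp, sub_apply, lp.coeFn_sub, Pi.sub_apply,
    smul_apply, lp.coeFn_smul, Pi.smul_apply, smul_eq_mul,
    ket_apply, freeOp_apply, weightOp_apply, cut_of_le (hd x)] at h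
  rw [sub_eq_iff_eq_add'] at h
  rw [mul_assoc]
  exact h

/-- A diagonal or off-diagonal block of the resolvent is bounded by one if the weights vanish on
the sites of the block. -/
theorem norm_res_le_one (hC : C ∈ Matrix.unitaryGroup (Fin 3) ℂ) (hz : ‖z‖ < 1)
    {d : Site → ℂ} {p q : Site × Fin 3} (hp : d p.1 = 0) (hq : d q.1 = 0) :
    ‖res C z d p q‖ ≤ 1 := by
  set ψ : H := Ring.inverse (weightedOp C z d) (ket q.1 q.2) with hψ
  have h0 : cut 0 = 0 := cut_of_le (by simp)
  have heq : freeOp C ψ = ket q.1 q.2 + z • weightOp d ψ := by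
    have := weightedOp_inverse_apply hC hz d (ket q.1 q.2)
    rw [weightedOp, sub_apply, sub_eq_iff_eq_add] at this
    exact this
  -- The weight vanishes at `q.1`, so Pythagoras applies to `heq`, whose left side has norm ‖ψ‖ by
  -- unitarity.
  have horth : inner ℂ (ket q.1 q.2) (z • weightOp d ψ) = 0 := by
    rw [inner_ket, lp.coeFn_smul, Pi.smul_apply, weightOp_apply]
    simp [hq, h0]
  have h1 : ‖ψ‖ ^ 2 = 1 + ‖z • weightOp d ψ‖ ^ 2 := by
    have := norm_add_sq_eq_norm_sq_add_norm_sq_of_inner_eq_zero (𝕜 := ℂ) _ _ horth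
    rw [← heq, norm_freeOp_apply hC, norm_ket] at this
    nlinarith
  -- The weight kills the entry at `p`, so ‖ψ p‖² is room to spare; against `h1` only the source
  -- term 1 remains to bound it.
  have h2 : ‖weightOp d ψ‖ ^ 2 + ‖ψ p‖ ^ 2 ≤ ‖ψ‖ ^ 2 := by
    have hs := (hasSum_norm_sq (weightOp d ψ)).add (hasSum_ite_eq p (‖ψ p‖ ^ 2))
    refine hasSum_le (fun r => ?_) hs (hasSum_norm_sq ψ)
    rw [weightOp_apply, norm_mul]
    split_ifs with h
    · subst h
      simp [hp, h0]
    · rw [add_zero]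
      gcongr
      exact mul_le_of_le_one_left (norm_nonneg _) (norm_cut_le _)
  have h3 : ‖z • weightOp d ψ‖ ≤ ‖weightOp d ψ‖ := by
    rw [norm_smul]
    exact mul_le_of_le_one_left (norm_nonneg _) hz.le
  have h4 : ‖z • weightOp d ψ‖ ^ 2 ≤ ‖weightOp d ψ‖ ^ 2 := by gcongr
  have h5 : ‖ψ p‖ ^ 2 ≤ 1 := by linarith
  exact (sq_le_one_iff₀ (norm_nonneg _)).1 h5

/-- The resolvent identity for two families of weights which differ at a single site. -/
theorem res_sub_res (hC : C ∈ Matrix.unitaryGroup (Fin 3) ℂ) (hz : ‖z‖ < 1)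
    {d d' : Site → ℂ} (hd : ∀ x, ‖d x‖ ≤ 1) (hd' : ∀ x, ‖d' x‖ ≤ 1) {a : Site}
    (ha : ∀ x, x ≠ a → d x = d' x) (p q : Site × Fin 3) :
    res C z d p q - res C z d' p q
      = z * (d a - d' a) * ∑ i, res C z d' p (a, i) * res C z d (a, i) q := by
  set R := Ring.inverse (weightedOp C z d) with hR
  set R' := Ring.inverse (weightedOp C z d') with hR'
  have h1 : weightedOp C z d * R = 1 := Ring.mul_inverse_cancel _ (isUnit_weightedOp hC hz d)
  have h2 : R' * weightedOp C z d' = 1 := Ring.inverse_mul_cancel _ (isUnit_weightedOp hC hz d')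
  have h3 : R - R' = R' * (weightedOp C z d' - weightedOp C z d) * R := by
    rw [mul_sub, sub_mul, h2, one_mul, mul_assoc, h1, mul_one]
  have h4 : ∀ ψ : H, (weightedOp C z d' - weightedOp C z d) ψ
      = ∑ i, (z * (d a - d' a) * ψ (a, i)) • ket a i := by
    intro ψ
    ext ⟨x, j⟩
    simp only [weightedOp, sub_sub_sub_cancel_left, sub_apply, lp.coeFn_sub,
      Pi.sub_apply, smul_apply, lp.coeFn_smul, Pi.smul_apply, smul_eq_mul,
      weightOp_apply, cut_of_le (hd _), cut_of_le (hd' _), lp.coeFn_sum, Finset.sum_apply,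
      ket_apply, Prod.mk.injEq]
    by_cases hx : x = a
    · subst hx
      simp
      ring
    · simp [hx, ha x hx]
  have h5 := congrArg (fun T : H →L[ℂ] H => T (ket q.1 q.2) p) h3
  simp only [mul_apply_eq_comp, h4, map_sum, map_smul, sub_apply,
    lp.coeFn_sub, Pi.sub_apply, lp.coeFn_sum, Finset.sum_apply, lp.coeFn_smul, Pi.smul_apply,
    smul_eq_mul] at h5
  rw [res, res, h5, Finset.mul_sum]
  refine Finset.sum_congr rfl fun i _ => ?_
  simp only [res]
  ring

/-- The resolvent is a Neumann series, and each coordinate of each of its terms is measurable in the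
weights. -/
theorem measurable_res (hC : C ∈ Matrix.unitaryGroup (Fin 3) ℂ) (hz : ‖z‖ < 1)
    (p q : Site × Fin 3) : Measurable fun d : Site → ℂ => res C z d p q := by
  -- The vector may depend on `d`, since `pow_succ` peels off the innermost factor.
  have hpow : ∀ (n : ℕ) (ψ : (Site → ℂ) → H), (∀ p, Measurable fun d => ψ d p) →
      ∀ p, Measurable fun d => ((z • (freeInvOp C * weightOp d)) ^ n) (ψ d) p := by
    intro n
    induction n with
    | zero => intro ψ hψ p; simpa using hψ p
    | succ n ih =>
      intro ψ hψ p
      simp only [pow_succ, mul_apply_eq_comp]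
      refine ih _ (fun p => ?_) p
      simp only [freeInvOp, smul_apply, mul_apply_eq_comp,
        lp.coeFn_smul, Pi.smul_apply, smul_eq_mul, coinOp_apply, shiftInvOp_apply, weightOp_apply]
      refine Measurable.const_mul (Finset.measurable_sum _ fun j _ => Measurable.const_mul ?_ _) _
      exact (measurable_cut.comp (measurable_pi_apply _)).mul (hψ _)
  have hlim : ∀ d : Site → ℂ, HasSum (fun n : ℕ =>
      ((z • (freeInvOp C * weightOp d)) ^ n) (freeInvOp C (ket q.1 q.2)) p) (res C z d p q) := by
    intro d
    have hn := norm_smul_freeInvOp_mul_weightOp hC hz d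
    have h1 : HasSum (fun n : ℕ => (z • (freeInvOp C * weightOp d)) ^ n)
        (Ring.inverse (1 - z • (freeInvOp C * weightOp d))) := by
      rw [NormedRing.inverse_one_sub _ hn]
      exact (summable_geometric_of_norm_lt_one hn).hasSum
    have h2 : Ring.inverse (weightedOp C z d)
        = Ring.inverse (1 - z • (freeInvOp C * weightOp d)) * freeInvOp C := by
      have hu := isUnit_one_sub_of_norm_lt_one hn
      have h3 : weightedOp C z d *
          (Ring.inverse (1 - z • (freeInvOp C * weightOp d)) * freeInvOp C) = 1 := by
        rw [weightedOp_eq hC, mul_assoc, ← mul_assoc (1 - _), Ring.mul_inverse_cancel _ hu, one_mul,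
          freeOp_mul_freeInvOp hC]
      have h4 := congrArg (Ring.inverse (weightedOp C z d) * ·) h3
      simp only [mul_one] at h4
      rw [← h4, ← mul_assoc, Ring.inverse_mul_cancel _ (isUnit_weightedOp hC hz d), one_mul]
    have h3 := (h1.mapL (ContinuousLinearMap.apply ℂ H (freeInvOp C (ket q.1 q.2)))).mapL
      (innerSL ℂ (ket p.1 p.2))
    simpa [inner_ket, res, h2] using h3
  refine measurable_of_tendsto_metrizable (f := fun N d => ∑ n ∈ Finset.range N,
      ((z • (freeInvOp C * weightOp d)) ^ n) (freeInvOp C (ket q.1 q.2)) p)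
    (fun N => Finset.measurable_sum _ fun n _ => hpow n (fun _ => _) (fun p => measurable_const) p) ?_
  rw [tendsto_pi_nhds]
  exact fun d => (hlim d).tendsto_sum_nat

end Resolvent

/-! ### Negative moments of polynomials on the circle -/

theorem ennreal_rpow_neg_le {x y : ℝ≥0∞} {t : ℝ} (ht : 0 ≤ t) (h : x ≤ y) :
    y ^ (-t) ≤ x ^ (-t) := by
  rw [ENNReal.rpow_neg, ENNReal.rpow_neg]
  exact ENNReal.inv_le_inv.2 (ENNReal.rpow_le_rpow h ht)

theorem multiset_prod_le_one {s : Multiset ℝ} (h : ∀ y ∈ s, 0 ≤ y ∧ y ≤ 1) : s.prod ≤ 1 := by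
  induction s using Multiset.induction_on with
  | empty => simp
  | cons a t ih =>
    rw [Multiset.prod_cons]
    have ha := h a (Multiset.mem_cons_self a t)
    have ht : ∀ y ∈ t, 0 ≤ y ∧ y ≤ 1 := fun y hy => h y (Multiset.mem_cons_of_mem hy)
    exact mul_le_one₀ ha.2 (Multiset.prod_nonneg fun y hy => (ht y hy).1) (ih ht)

/-- The uniform distribution on `[0, 2π)`. -/
noncomputable def uniformAngle : Measure ℝ := ProbabilityTheory.cond volume (Set.Ico 0 (2 * Real.pi))

instance : IsProbabilityMeasure uniformAngle :=
  cond_isProbabilityMeasure_of_finite (by simp [Real.pi_pos])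
    (by rw [Real.volume_Ico]; exact ENNReal.ofReal_ne_top)

/-- The point `e^{-it}` of the unit circle. -/
noncomputable def circlePt (t : ℝ) : ℂ := Complex.exp (-(t : ℂ) * Complex.I)

theorem norm_circlePt (t : ℝ) : ‖circlePt t‖ = 1 := by
  rw [circlePt, ← Complex.ofReal_neg, Complex.norm_exp_ofReal_mul_I]

theorem continuous_circlePt : Continuous circlePt := by
  unfold circlePt
  fun_prop

theorem lintegral_uniformAngle (f : ℝ → ℝ≥0∞) :
    ∫⁻ t, f t ∂uniformAngle
      = (ENNReal.ofReal (2 * Real.pi))⁻¹ * ∫⁻ t in Set.Ioc 0 (2 * Real.pi), f t := by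
  rw [uniformAngle, ProbabilityTheory.cond, lintegral_smul_measure, Real.volume_Ico, sub_zero,
    smul_eq_mul, Measure.restrict_congr_set Ico_ae_eq_Ioc]

theorem norm_circlePt_sub (t φ : ℝ) :
    ‖circlePt t - circlePt φ‖ = ‖2 * Real.sin ((t - φ) / 2)‖ := by
  rw [← Complex.norm_exp_I_mul_ofReal_sub_one]
  have : circlePt t - circlePt φ
      = -(circlePt t * (Complex.exp (Complex.I * ((t - φ : ℝ) : ℂ)) - 1)) := by
    rw [mul_sub, mul_one, circlePt, ← Complex.exp_add, circlePt]
    push_cast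
    ring_nf
  rw [this, norm_neg, norm_mul, norm_circlePt, one_mul]

theorem lintegral_abs_rpow_neg_lt_top {τ : ℝ} (hτ : τ < 1) :
    ∫⁻ u in Set.Ioc (-Real.pi) Real.pi, ENNReal.ofReal (|u| ^ (-τ)) < ⊤ := by
  have h1 : IntervalIntegrable (fun u : ℝ => |u| ^ (-τ)) volume 0 Real.pi := by
    refine IntervalIntegrable.congr_uIoo
      (intervalIntegral.intervalIntegrable_rpow' (by linarith : -1 < -τ)) (fun u hu => ?_)
    rw [Set.uIoo_of_le Real.pi_pos.le] at hu
    simp only [abs_of_pos hu.1]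
  have h2 : IntervalIntegrable (fun u : ℝ => |u| ^ (-τ)) volume (-Real.pi) 0 := by
    have := (IntervalIntegrable.iff_comp_neg (by simp)).1 h1
    simp only [abs_neg, neg_zero] at this
    exact this.symm
  have h3 := (intervalIntegrable_iff_integrableOn_Ioc_of_le (by linarith [Real.pi_pos])).1
    (h2.trans h1)
  exact h3.lintegral_lt_top

/-- Negative moments of order less than one of the distance to a point of the circle. -/
theorem exists_lintegral_circlePt_sub_le {τ : ℝ} (hτ0 : 0 ≤ τ) (hτ : τ < 1) :
    ∃ K : ℝ≥0∞, K ≠ ⊤ ∧ ∀ φ : ℝ,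
      ∫⁻ t, ‖circlePt t - circlePt φ‖ₑ ^ (-τ) ∂uniformAngle ≤ K := by
  set f : ℝ → ℝ≥0∞ := fun u => ‖2 * Real.sin (u / 2)‖ₑ ^ (-τ) with hf
  refine ⟨(ENNReal.ofReal (2 * Real.pi))⁻¹ *
    ∫⁻ u in Set.Ioc (-Real.pi) Real.pi, f u, ?_, fun φ => ?_⟩
  · refine ENNReal.mul_ne_top (by simp [Real.pi_pos]) (ne_of_lt ?_)
    -- Jordan's inequality compares the chord with |u|, reducing to the integrable |u|^(-τ).
    have hle : ∀ᵐ u : ℝ, u ∈ Set.Ioc (-Real.pi) Real.pi → f u ≤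
        ENNReal.ofReal ((2 / Real.pi) ^ (-τ)) * ENNReal.ofReal (|u| ^ (-τ)) := by
      filter_upwards [Measure.ae_ne volume (0 : ℝ)] with u h0 hu
      have hu2 : |u / 2| ≤ Real.pi / 2 := by
        rw [abs_le]
        constructor <;> linarith [hu.1, hu.2]
      have hs := Real.mul_abs_le_abs_sin hu2
      have hpos : 0 < 2 / Real.pi * |u| := by positivity
      have hle : 2 / Real.pi * |u| ≤ |2 * Real.sin (u / 2)| := by
        rw [abs_mul, abs_two]
        rw [abs_div, abs_two] at hs
        linarith
      rw [← ENNReal.ofReal_mul (by positivity), ← Real.mul_rpow (by positivity) (abs_nonneg _), hf]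
      simp only
      rw [← ofReal_norm, Real.norm_eq_abs, ENNReal.ofReal_rpow_of_pos (hpos.trans_le hle)]
      exact ENNReal.ofReal_le_ofReal (Real.rpow_le_rpow_of_nonpos hpos hle (by linarith))
    refine (setLIntegral_mono_ae' measurableSet_Ioc hle).trans_lt ?_
    rw [lintegral_const_mul' _ _ ENNReal.ofReal_ne_top]
    exact ENNReal.mul_lt_top ENNReal.ofReal_lt_top (lintegral_abs_rpow_neg_lt_top hτ)
  · rw [lintegral_uniformAngle]
    refine le_of_eq (congrArg _ ?_)
    have hT : (0 : ℝ) < 2 * Real.pi := by positivity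
    have hper : ∀ t, f (t + 2 * Real.pi) = f t := by
      intro t
      simp only [hf]
      rw [show (t + 2 * Real.pi) / 2 = t / 2 + Real.pi by ring, Real.sin_add_pi, mul_neg, enorm_neg]
    have h1 : ∀ t, ‖circlePt t - circlePt φ‖ₑ ^ (-τ) = f (t - φ) := by
      intro t
      rw [hf, ← ofReal_norm, norm_circlePt_sub, ofReal_norm]
    simp only [h1]
    -- By periodicity the period may be centred at `φ`, which removes the dependence on `φ`.
    have h2 := (isAddFundamentalDomain_Ioc hT 0 (μ := volume)).setLIntegral_eq
      (isAddFundamentalDomain_Ioc hT (φ - Real.pi) (μ := volume)) (fun t => f (t - φ)) (by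
        rintro ⟨g, hg⟩ t
        obtain ⟨k, rfl⟩ := AddSubgroup.mem_zmultiples_iff.1 hg
        have := (Function.Periodic.int_mul hper k) (t - φ)
        rw [← this]
        congr 1
        simp [AddSubgroup.mk_vadd]
        ring)
    rw [zero_add] at h2
    rw [h2]
    have h3 := (measurePreserving_sub_right (volume : Measure ℝ) φ).setLIntegral_comp_preimage_emb
      (measurableEmbedding_subRight φ) f (Set.Ioc (-Real.pi) Real.pi)
    rw [← h3]
    congr 2
    ext t
    simp only [Set.mem_Ioc, Set.mem_preimage]
    constructor <;> rintro ⟨h4, h5⟩ <;> constructor <;> linarith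

/-- Let u be the radial projection of v and w a point of the circle. Then |w - u| ≤ 2|w - v|, |w -
u| ≤ 2 and |v| ≤ 1 + |w - v|; together these give 4 + 2 = 6. -/
theorem exists_circlePt_mul_le (v : ℂ) : ∃ φ : ℝ, ∀ t : ℝ,
    ‖circlePt t - circlePt φ‖ * (1 + ‖v‖) ≤ 6 * ‖circlePt t - v‖ := by
  refine ⟨-v.arg, fun t => ?_⟩
  set u := circlePt (-v.arg) with hu
  have h0 : v - u = ((‖v‖ - 1 : ℝ) : ℂ) * u := by
    have h := Complex.norm_mul_exp_arg_mul_I v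
    have : u = Complex.exp (v.arg * Complex.I) := by rw [hu, circlePt]; simp
    rw [← this] at h
    push_cast
    linear_combination -h
  have h1 : ‖v - u‖ ≤ ‖circlePt t - v‖ := by
    rw [h0, norm_mul, hu, norm_circlePt, mul_one, Complex.norm_real, Real.norm_eq_abs,
      ← norm_circlePt t, abs_sub_comm]
    exact abs_norm_sub_norm_le _ _
  have h2 : ‖circlePt t - u‖ ≤ ‖circlePt t - v‖ + ‖v - u‖ := norm_sub_le_norm_sub_add_norm_sub _ _ _
  have h3 : ‖circlePt t - u‖ ≤ 2 := by
    refine (norm_sub_le _ _).trans ?_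
    rw [norm_circlePt, hu, norm_circlePt]
    norm_num
  have h4 : ‖v‖ ≤ 1 + ‖circlePt t - v‖ := by
    have := norm_sub_norm_le v (circlePt t)
    rw [norm_circlePt, norm_sub_rev] at this
    linarith
  nlinarith [norm_nonneg (circlePt t - v), norm_nonneg (circlePt t - u)]

/-- Negative moments of order less than one of `|w - v| / (1 + |v|)`, uniformly in `v`. -/
theorem exists_lintegral_root_le {τ : ℝ} (hτ0 : 0 ≤ τ) (hτ : τ < 1) :
    ∃ K : ℝ≥0∞, K ≠ ⊤ ∧ ∀ v : ℂ,
      ∫⁻ t, ENNReal.ofReal (‖circlePt t - v‖ / (1 + ‖v‖)) ^ (-τ) ∂uniformAngle ≤ K := by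
  obtain ⟨K, hK, h⟩ := exists_lintegral_circlePt_sub_le hτ0 hτ
  refine ⟨ENNReal.ofReal (1 / 6) ^ (-τ) * K, ENNReal.mul_ne_top ?_ hK, fun v => ?_⟩
  · rw [ENNReal.ofReal_rpow_of_pos (by norm_num)]
    exact ENNReal.ofReal_ne_top
  obtain ⟨φ, hφ⟩ := exists_circlePt_mul_le v
  have hc : ENNReal.ofReal (1 / 6) ^ (-τ) ≠ ⊤ := by
    rw [ENNReal.ofReal_rpow_of_pos (by norm_num)]
    exact ENNReal.ofReal_ne_top
  refine le_trans ?_ (mul_le_mul_right (h φ) _)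
  rw [← lintegral_const_mul' _ _ hc]
  refine lintegral_mono fun t => ?_
  rw [← ofReal_norm, ← ENNReal.mul_rpow_of_ne_top ENNReal.ofReal_ne_top ENNReal.ofReal_ne_top,
    ← ENNReal.ofReal_mul (by norm_num)]
  refine ennreal_rpow_neg_le (by assumption) (ENNReal.ofReal_le_ofReal ?_)
  rw [le_div_iff₀ (by positivity)]
  linarith [hφ t]

/-- The smallest factor works. This trades a negative moment of a product for negative moments of
single factors, of an order multiplied by the number of factors. -/
theorem exists_pow_card_le_prod {s : Multiset ℝ} (hs : s ≠ 0) (h : ∀ y ∈ s, 0 ≤ y) :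
    ∃ m ∈ s, m ^ s.card ≤ s.prod := by
  induction s using Multiset.induction_on with
  | empty => exact absurd rfl hs
  | cons a t ih =>
    by_cases ht : t = 0
    · subst ht
      exact ⟨a, by simp, by simp⟩
    obtain ⟨m, hm, hle⟩ := ih ht fun y hy => h y (Multiset.mem_cons_of_mem hy)
    have ha : 0 ≤ a := h a (Multiset.mem_cons_self a t)
    have hm0 : 0 ≤ m := h m (Multiset.mem_cons_of_mem hm)
    rw [Multiset.prod_cons, Multiset.card_cons]
    rcases le_total a m with ham | ham
    · refine ⟨a, Multiset.mem_cons_self a t, ?_⟩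
      rw [pow_succ']
      exact mul_le_mul_of_nonneg_left ((pow_le_pow_left₀ ha ham _).trans hle) ha
    · refine ⟨m, Multiset.mem_cons_of_mem hm, ?_⟩
      rw [pow_succ']
      exact mul_le_mul ham hle (pow_nonneg hm0 _) ha

/-- Negative moments of a polynomial of bounded degree over the unit circle. -/
theorem exists_lintegral_eval_rpow_neg_le (n : ℕ) {t : ℝ} (ht0 : 0 < t) (ht : n * t < 1) :
    ∃ K : ℝ≥0∞, K ≠ ⊤ ∧ ∀ p : Polynomial ℂ, p ≠ 0 → p.natDegree ≤ n →
      ∃ N : ℝ, 0 < N ∧ (∀ w : ℂ, ‖w‖ ≤ 1 → ‖p.eval w‖ ≤ N) ∧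
        ∫⁻ x, ‖p.eval (circlePt x)‖ₑ ^ (-t) ∂uniformAngle ≤ ENNReal.ofReal N ^ (-t) * K := by
  obtain ⟨K, hK, h⟩ := exists_lintegral_root_le (τ := n * t) (by positivity) ht
  -- At most `n` distinct roots contribute `K` each; the 1 covers a polynomial without roots.
  refine ⟨1 + n * K, by finiteness, fun p hp hn => ?_⟩
  -- Dividing each root factor |w - v| by 1 + |v| makes it at most one on the disc, so `N` bounds
  -- the polynomial there.
  set N : ℝ := ‖p.leadingCoeff‖ * (p.roots.map fun v => 1 + ‖v‖).prod with hN
  have hNpos : 0 < N := by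
    refine mul_pos (by simpa using hp) (Multiset.prod_pos ?_)
    intro a ha
    obtain ⟨v, -, rfl⟩ := Multiset.mem_map.1 ha
    positivity
  have heval : ∀ w, p.eval w = p.leadingCoeff * (p.roots.map fun v => w - v).prod := by
    intro w
    exact (IsAlgClosed.splits p).eval_eq_prod_roots w
  have hnorm : ∀ w, ‖p.eval w‖ = N * (p.roots.map fun v => ‖w - v‖ / (1 + ‖v‖)).prod := by
    intro w
    have h1 : (p.roots.map fun v => ‖w - v‖).prod
        = (p.roots.map fun v => 1 + ‖v‖).prod *
          (p.roots.map fun v => ‖w - v‖ / (1 + ‖v‖)).prod := by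
      rw [← Multiset.prod_map_mul]
      congr 1
      refine Multiset.map_congr rfl fun v _ => ?_
      field_simp
    rw [heval, norm_mul, hN, mul_assoc, ← h1]
    congr 1
    have := map_multiset_prod (normHom : ℂ →*₀ ℝ) (p.roots.map fun v => w - v)
    rw [Multiset.map_map] at this
    exact this
  have hratio : ∀ w v : ℂ, ‖w‖ ≤ 1 → ‖w - v‖ / (1 + ‖v‖) ≤ 1 := by
    intro w v hw
    rw [div_le_one (by positivity)]
    exact (norm_sub_le _ _).trans (by linarith)
  refine ⟨N, hNpos, fun w hw => ?_, ?_⟩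
  · rw [hnorm]
    refine mul_le_of_le_one_right hNpos.le (multiset_prod_le_one fun y hy => ?_)
    obtain ⟨v, -, rfl⟩ := Multiset.mem_map.1 hy
    exact ⟨by positivity, hratio w v hw⟩
  have hpt : ∀ x, ‖p.eval (circlePt x)‖ₑ ^ (-t) ≤ ENNReal.ofReal N ^ (-t) *
      (1 + ∑ v ∈ p.roots.toFinset,
        ENNReal.ofReal (‖circlePt x - v‖ / (1 + ‖v‖)) ^ (-(n * t))) := by
    intro x
    rw [← ofReal_norm, hnorm, ENNReal.ofReal_mul hNpos.le,
      ENNReal.mul_rpow_of_ne_top ENNReal.ofReal_ne_top ENNReal.ofReal_ne_top]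
    gcongr
    by_cases hr : p.roots = 0
    · simp [hr]
    obtain ⟨m, hm, hle⟩ := exists_pow_card_le_prod
      (s := p.roots.map fun v => ‖circlePt x - v‖ / (1 + ‖v‖)) (by simpa using hr) (by
        intro y hy
        obtain ⟨v, -, rfl⟩ := Multiset.mem_map.1 hy
        positivity)
    obtain ⟨v, hv, rfl⟩ := Multiset.mem_map.1 hm
    set y := ‖circlePt x - v‖ / (1 + ‖v‖) with hy
    have hy0 : 0 ≤ y := by positivity
    have hy1 : y ≤ 1 := hratio _ _ (norm_circlePt x).le
    have h1 : y ^ n ≤ (p.roots.map fun v => ‖circlePt x - v‖ / (1 + ‖v‖)).prod := by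
      refine le_trans (pow_le_pow_of_le_one hy0 hy1 ?_) hle
      rw [Multiset.card_map]
      exact (Polynomial.card_roots' p).trans hn
    calc _ ≤ ENNReal.ofReal (y ^ n) ^ (-t) :=
          ennreal_rpow_neg_le ht0.le (ENNReal.ofReal_le_ofReal h1)
      _ = ENNReal.ofReal y ^ (-(n * t)) := by
          rw [ENNReal.ofReal_pow hy0, ← ENNReal.rpow_natCast, ← ENNReal.rpow_mul, mul_neg]
      _ ≤ _ := le_trans (Finset.single_le_sum
          (f := fun v => ENNReal.ofReal (‖circlePt x - v‖ / (1 + ‖v‖)) ^ (-(n * t)))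
          (fun _ _ => zero_le) (Multiset.mem_toFinset.2 hv)) le_add_self
  have hNt : ENNReal.ofReal N ^ (-t) ≠ ⊤ := by
    rw [ENNReal.ofReal_rpow_of_pos hNpos]
    exact ENNReal.ofReal_ne_top
  have hmeas : ∀ v : ℂ, Measurable fun x =>
      ENNReal.ofReal (‖circlePt x - v‖ / (1 + ‖v‖)) ^ (-(n * t)) := by
    intro v
    have := continuous_circlePt.measurable
    fun_prop
  refine (lintegral_mono hpt).trans ?_
  rw [lintegral_const_mul' _ _ hNt, lintegral_add_left measurable_const,
    lintegral_finsetSum _ fun v _ => hmeas v, lintegral_const, measure_univ, mul_one]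
  gcongr
  refine (Finset.sum_le_sum fun v _ => h v).trans ?_
  rw [Finset.sum_const, nsmul_eq_mul]
  gcongr
  exact (Multiset.toFinset_card_le _).trans ((Polynomial.card_roots' p).trans hn)

/-! ### Cramer's rule for the 3×3 system -/

/-- The polynomial `w ↦ det (1 - w B)`. -/
noncomputable def detPoly (B : Matrix (Fin 3) (Fin 3) ℂ) : Polynomial ℂ :=
  ((Polynomial.X : Polynomial ℂ) • (-B).map Polynomial.C +
    (1 : Matrix (Fin 3) (Fin 3) ℂ).map Polynomial.C).det

theorem natDegree_detPoly_le (B : Matrix (Fin 3) (Fin 3) ℂ) : (detPoly B).natDegree ≤ 3 := by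
  rw [detPoly]
  exact (Polynomial.natDegree_det_X_add_C_le (-B) 1).trans (by simp)

theorem eval_det_X_add_C (A B : Matrix (Fin 3) (Fin 3) ℂ) (w : ℂ) :
    (((Polynomial.X : Polynomial ℂ) • A.map Polynomial.C + B.map Polynomial.C).det).eval w
      = (w • A + B).det := by
  rw [← Polynomial.coe_evalRingHom, RingHom.map_det]
  congr 1
  ext i j
  simp
  exact mul_comm _ _

theorem eval_detPoly (B : Matrix (Fin 3) (Fin 3) ℂ) (w : ℂ) :
    (detPoly B).eval w = (1 - w • B).det := by
  rw [detPoly, eval_det_X_add_C, smul_neg, neg_add_eq_sub]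

theorem eval_zero_detPoly (B : Matrix (Fin 3) (Fin 3) ℂ) : (detPoly B).eval 0 = 1 := by
  simp [eval_detPoly]

theorem detPoly_ne_zero (B : Matrix (Fin 3) (Fin 3) ℂ) : detPoly B ≠ 0 := by
  intro h
  have := eval_zero_detPoly B
  simp [h] at this

/-- The adjugate, used in place of the inverse, needs no invertibility and has entries bounded on
the disc. -/
theorem det_mul_eq_sum_adjugate {B : Matrix (Fin 3) (Fin 3) ℂ} {w : ℂ} {γ ρ : Fin 3 → ℂ}
    (h : ∀ i, γ i = ρ i + w * ∑ j, B i j * γ j) :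
    (1 - w • B).det • γ = (1 - w • B).adjugate.mulVec ρ := by
  have h1 : (1 - w • B).mulVec γ = ρ := by
    rw [Matrix.sub_mulVec, Matrix.one_mulVec, Matrix.smul_mulVec]
    funext i
    simp only [Pi.sub_apply, Pi.smul_apply, smul_eq_mul, Matrix.mulVec, dotProduct]
    rw [h i]
    ring
  rw [← h1, Matrix.mulVec_mulVec, Matrix.adjugate_mul, Matrix.smul_mulVec, Matrix.one_mulVec]

/-- By Cramer's rule the solution of `(1 - w B) γ = ρ`, multiplied by the determinant, is a
polynomial in `w`. -/
theorem exists_cramer_poly (B : Matrix (Fin 3) (Fin 3) ℂ) (ρ : Fin 3 → ℂ) (j : Fin 3) :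
    ∃ p : Polynomial ℂ, p.natDegree ≤ 3 ∧ ∀ (w : ℂ) (γ : Fin 3 → ℂ),
      (∀ i, γ i = ρ i + w * ∑ k, B i k * γ k) → p.eval w = (1 - w • B).det * γ j := by
  refine ⟨_, (Polynomial.natDegree_det_X_add_C_le ((-B).updateCol j 0)
    ((1 : Matrix (Fin 3) (Fin 3) ℂ).updateCol j ρ)).trans (by simp), fun w γ h => ?_⟩
  have h1 := congrFun (det_mul_eq_sum_adjugate h) j
  rw [Pi.smul_apply, smul_eq_mul, ← Matrix.cramer_eq_adjugate_mulVec, Matrix.cramer_apply] at h1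
  rw [h1, eval_det_X_add_C]
  congr 1
  ext i k
  by_cases hk : k = j
  · subst hk
    simp
  · simp [Matrix.updateCol_ne hk, sub_eq_neg_add]

theorem norm_one_sub_smul_apply_le {B : Matrix (Fin 3) (Fin 3) ℂ} (hB : ∀ i j, ‖B i j‖ ≤ 1) {w : ℂ}
    (hw : ‖w‖ ≤ 1) (i j : Fin 3) : ‖(1 - w • B) i j‖ ≤ 2 := by
  have h1 : ‖(1 : Matrix (Fin 3) (Fin 3) ℂ) i j‖ ≤ 1 := by
    rw [Matrix.one_apply]
    split_ifs <;> simp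
  have h2 : ‖w * B i j‖ ≤ 1 := by
    rw [norm_mul]
    exact mul_le_one₀ hw (norm_nonneg _) (hB i j)
  refine (norm_sub_le _ _).trans ?_
  rw [Matrix.smul_apply, smul_eq_mul]
  linarith

theorem norm_adjugate_apply_le {M : Matrix (Fin 3) (Fin 3) ℂ} (hM : ∀ i j, ‖M i j‖ ≤ 2)
    (i j : Fin 3) : ‖M.adjugate i j‖ ≤ 8 := by
  have key : ∀ i j k l i' j' k' l', ‖M i j * M k l - M i' j' * M k' l'‖ ≤ 8 := by
    intro i j k l i' j' k' l'
    refine (norm_sub_le _ _).trans ?_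
    rw [norm_mul, norm_mul]
    nlinarith [mul_le_mul (hM i j) (hM k l) (norm_nonneg _) zero_le_two,
      mul_le_mul (hM i' j') (hM k' l') (norm_nonneg _) zero_le_two]
  have key' : ∀ i j k l i' j' k' l', ‖-(M i j * M k l) + M i' j' * M k' l'‖ ≤ 8 := by
    intro i j k l i' j' k' l'
    rw [neg_add_eq_sub]
    exact key _ _ _ _ _ _ _ _
  rw [Matrix.adjugate_fin_three]
  fin_cases i <;> fin_cases j <;> first | exact key _ _ _ _ _ _ _ _ | exact key' _ _ _ _ _ _ _ _

theorem norm_det_le {M : Matrix (Fin 3) (Fin 3) ℂ} (hM : ∀ i j, ‖M i j‖ ≤ 2) : ‖M.det‖ ≤ 48 := by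
  rw [M.det_eq_sum_mul_adjugate_row 0]
  have h : ∀ j ∈ Finset.univ, ‖M 0 j * M.adjugate j 0‖ ≤ 16 := by
    intro j _
    rw [norm_mul]
    nlinarith [mul_le_mul (hM 0 j) (norm_adjugate_apply_le hM j 0) (norm_nonneg _) zero_le_two]
  refine (norm_sum_le_of_le Finset.univ h).trans ?_
  norm_num

theorem norm_det_mul_le {B : Matrix (Fin 3) (Fin 3) ℂ} (hB : ∀ i j, ‖B i j‖ ≤ 1) {w : ℂ}
    (hw : ‖w‖ ≤ 1) {γ ρ : Fin 3 → ℂ} (h : ∀ i, γ i = ρ i + w * ∑ j, B i j * γ j) (i : Fin 3) :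
    ‖(1 - w • B).det‖ * ‖γ i‖ ≤ 8 * ∑ j, ‖ρ j‖ := by
  have h1 := congrFun (det_mul_eq_sum_adjugate h) i
  rw [Pi.smul_apply, smul_eq_mul] at h1
  rw [← norm_mul, h1, Finset.mul_sum]
  have hj : ∀ j ∈ Finset.univ, ‖(1 - w • B).adjugate i j * ρ j‖ ≤ 8 * ‖ρ j‖ := by
    intro j _
    rw [norm_mul]
    exact mul_le_mul_of_nonneg_right
      (norm_adjugate_apply_le (norm_one_sub_smul_apply_le hB hw) i j) (norm_nonneg _)
  exact norm_sum_le_of_le Finset.univ hj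

/-- The hypothesis makes 1 + wG a right inverse of 1 - wB. -/
theorem det_one_sub_smul_ne_zero {B G : Matrix (Fin 3) (Fin 3) ℂ} {w : ℂ}
    (h : G = B + w • (B * G)) : (1 - w • B).det ≠ 0 := by
  have h1 : (1 - w • B) * (1 + w • G) = 1 := by
    have h2 : w • G = w • B + w • (w • (B * G)) := by
      rw [← smul_add, ← h]
    rw [sub_mul, one_mul, mul_add, mul_one, smul_mul_smul_comm, h2, smul_smul]
    abel
  intro h0
  have := congrArg Matrix.det h1
  rw [Matrix.det_mul, h0, zero_mul, Matrix.det_one] at this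
  exact zero_ne_one this

/-- Fractional moments, of order less than `1/3`, of the solution of `(1 - w B) γ = ρ` for a
random point `w` of the circle. -/
theorem exists_lintegral_solution_le {t : ℝ} (ht0 : 0 < t) (ht : t < 1 / 3) :
    ∃ K : ℝ≥0∞, K ≠ ⊤ ∧ ∀ B : Matrix (Fin 3) (Fin 3) ℂ, (∀ i j, ‖B i j‖ ≤ 1) →
      (∀ x, (1 - circlePt x • B).det ≠ 0) → ∀ (γ : ℝ → Fin 3 → ℂ) (ρ : Fin 3 → ℂ),
      (∀ x i, γ x i = ρ i + circlePt x * ∑ j, B i j * γ x j) → ∀ i,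
      ∫⁻ x, ‖γ x i‖ₑ ^ t ∂uniformAngle ≤ K * (∑ j, ‖ρ j‖ₑ) ^ t := by
  obtain ⟨K, hK, h⟩ := exists_lintegral_eval_rpow_neg_le 3 ht0 (by push_cast; linarith)
  refine ⟨K * 8 ^ t, ENNReal.mul_ne_top hK (ENNReal.rpow_ne_top_of_nonneg ht0.le (by norm_num)), ?_⟩
  intro B hB hdet γ ρ hγ i
  obtain ⟨N, hN, hle, hint⟩ := h (detPoly B) (detPoly_ne_zero B) (natDegree_detPoly_le B)
  -- The determinant is 1 at w = 0; this normalisation makes the bound uniform in `B`.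
  have hN1 : 1 ≤ N := by
    have := hle 0 (by simp)
    rwa [eval_zero_detPoly, norm_one] at this
  have hNt : ENNReal.ofReal N ^ (-t) ≤ 1 := by
    have := ennreal_rpow_neg_le ht0.le (ENNReal.one_le_ofReal.2 hN1)
    rwa [ENNReal.one_rpow] at this
  have hpt : ∀ x, ‖γ x i‖ₑ ^ t
      ≤ ‖(detPoly B).eval (circlePt x)‖ₑ ^ (-t) * (8 * ∑ j, ‖ρ j‖ₑ) ^ t := by
    intro x
    have h1 : ‖(1 - circlePt x • B).det‖ₑ * ‖γ x i‖ₑ ≤ 8 * ∑ j, ‖ρ j‖ₑ := by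
      have h2 := ENNReal.ofReal_le_ofReal (norm_det_mul_le hB (norm_circlePt x).le (hγ x) i)
      rw [ENNReal.ofReal_mul (norm_nonneg _), ENNReal.ofReal_mul (by norm_num),
        ENNReal.ofReal_sum_of_nonneg fun _ _ => norm_nonneg _] at h2
      simpa using h2
    have h3 : ‖(1 - circlePt x • B).det‖ₑ ≠ 0 := by simpa using hdet x
    rw [eval_detPoly, ENNReal.rpow_neg, ← ENNReal.inv_rpow,
      ← ENNReal.mul_rpow_of_nonneg _ _ ht0.le]
    refine ENNReal.rpow_le_rpow ?_ ht0.le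
    rw [mul_comm, ← div_eq_mul_inv, ENNReal.le_div_iff_mul_le (Or.inl h3) (Or.inl enorm_ne_top),
      mul_comm]
    exact h1
  refine (lintegral_mono hpt).trans ?_
  rw [lintegral_mul_const'' _ (by
    have := continuous_circlePt.measurable
    have : Measurable fun x => (detPoly B).eval (circlePt x) :=
      (detPoly B).continuous.measurable.comp this
    exact (this.enorm.pow_const _).aemeasurable), ENNReal.mul_rpow_of_nonneg _ _ ht0.le, ← mul_assoc]
  gcongr
  refine hint.trans ?_
  exact mul_le_of_le_one_left (zero_le) hNt

/-! ### Decoupling the small divisor -/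

theorem two_le_add_inv (a : ℝ≥0∞) : 2 ≤ a + a⁻¹ := by
  by_cases h0 : a = 0
  · simp [h0]
  by_cases h1 : a = ⊤
  · simp [h1]
  lift a to NNReal using h1
  have h2 : a ≠ 0 := by simpa using h0
  rw [← ENNReal.coe_inv h2]
  have : (2 : NNReal) ≤ a + a⁻¹ := by
    rw [← NNReal.coe_le_coe]
    push_cast
    have ha : (0 : ℝ) < a := by positivity
    have : (a : ℝ) + (a : ℝ)⁻¹ - 2 = (a - 1) ^ 2 * (a : ℝ)⁻¹ := by
      field_simp
      ring
    have h3 : 0 ≤ ((a : ℝ) - 1) ^ 2 * (a : ℝ)⁻¹ := by positivity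
    linarith
  exact_mod_cast this

/-- A lower bound for a moment by an upper bound for the opposite moment. -/
theorem one_le_mul_lintegral {α : Type*} [MeasurableSpace α] {μ : Measure α}
    [IsProbabilityMeasure μ] {f : α → ℝ≥0∞} (hf : Measurable f) {K : ℝ≥0∞} (hK0 : K ≠ 0)
    (hK : K ≠ ⊤) (h : ∫⁻ x, (f x)⁻¹ ∂μ ≤ K) : 1 ≤ K * ∫⁻ x, f x ∂μ := by
  have h1 : (2 : ℝ≥0∞) ≤ ∫⁻ x, (K * f x + K⁻¹ * (f x)⁻¹) ∂μ := by
    calc (2 : ℝ≥0∞) = ∫⁻ _, 2 ∂μ := by simp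
      _ ≤ _ := lintegral_mono fun x => by
        refine (two_le_add_inv (K * f x)).trans (le_of_eq ?_)
        rw [ENNReal.mul_inv (Or.inl hK0) (Or.inl hK)]
  rw [lintegral_add_left (hf.const_mul K), lintegral_const_mul _ hf,
    lintegral_const_mul' _ _ (ENNReal.inv_ne_top.2 hK0)] at h1
  have h2 : K⁻¹ * ∫⁻ x, (f x)⁻¹ ∂μ ≤ 1 := by
    rw [← ENNReal.inv_mul_cancel hK0 hK]
    gcongr
  have h3 : (1 : ℝ≥0∞) + 1 ≤ K * ∫⁻ x, f x ∂μ + 1 := by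
    rw [one_add_one_eq_two]
    exact h1.trans (by gcongr)
  exact (ENNReal.add_le_add_iff_right ENNReal.one_ne_top).1 h3

/-- Decoupling: a singular factor `|1 - ζ w³|⁻ʳ` may be averaged separately from the fractional
moment of an affine function of the solution of `(1 - w B) γ = ρ`. -/
theorem exists_lintegral_decouple_le {r : ℝ} (hr0 : 0 < r) (hr : r < 1 / 6) :
    ∃ K : ℝ≥0∞, K ≠ ⊤ ∧ ∀ B : Matrix (Fin 3) (Fin 3) ℂ, (∀ i j, ‖B i j‖ ≤ 1) →
      (∀ x, (1 - circlePt x • B).det ≠ 0) → ∀ (γ : ℝ → Fin 3 → ℂ) (ρ : Fin 3 → ℂ),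
      (∀ x i, γ x i = ρ i + circlePt x * ∑ j, B i j * γ x j) → ∀ (ζ α : ℂ) (β : Fin 3 → ℂ),
      ∫⁻ x, ‖1 - ζ * circlePt x ^ 3‖ₑ ^ (-r) *
          ‖α + circlePt x * ∑ j, β j * γ x j‖ₑ ^ r ∂uniformAngle
        ≤ K * ∫⁻ x, ‖α + circlePt x * ∑ j, β j * γ x j‖ₑ ^ r ∂uniformAngle := by
  obtain ⟨K, hK, h⟩ := exists_lintegral_eval_rpow_neg_le 6 hr0 (by push_cast; linarith)
  -- 48 bounds the determinant on the disc; `K + 1` replaces `K` where a nonzero constant is needed.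
  refine ⟨K * (48 ^ r * (K + 1)), by finiteness, ?_⟩
  intro B hB hdet γ ρ hγ ζ α β
  choose c hc hceval using exists_cramer_poly B ρ
  set q := detPoly B with hq
  -- By Cramer's rule `p` is the numerator of the affine function over the denominator `q`.
  set p : Polynomial ℂ := q * Polynomial.C α +
    Polynomial.X * ∑ j, Polynomial.C (β j) * c j with hp
  set q' : Polynomial ℂ := 1 - Polynomial.C ζ * Polynomial.X ^ 3 with hq'
  set g : ℝ → ℂ := fun x => α + circlePt x * ∑ j, β j * γ x j with hg
  have hqd : q.natDegree ≤ 3 := natDegree_detPoly_le B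
  have hq'd : q'.natDegree ≤ 3 := by
    rw [hq']
    compute_degree
  have hpd : p.natDegree ≤ 6 := by
    have hsum : (∑ j, Polynomial.C (β j) * c j).natDegree ≤ 3 :=
      Polynomial.natDegree_sum_le_of_forall_le _ _ fun j _ =>
        (Polynomial.natDegree_C_mul_le _ _).trans (hc j)
    refine Polynomial.natDegree_add_le_of_degree_le ?_ ?_
    · exact (Polynomial.natDegree_mul_C_le _ _).trans (hqd.trans (by norm_num))
    · refine Polynomial.natDegree_mul_le.trans ?_
      rw [Polynomial.natDegree_X]
      omega
  have hqx : ∀ x, q.eval (circlePt x) ≠ 0 := fun x => by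
    rw [hq, eval_detPoly]
    exact hdet x
  have hpx : ∀ x, p.eval (circlePt x) = q.eval (circlePt x) * g x := by
    intro x
    simp only [hp, hg, Polynomial.eval_add, Polynomial.eval_mul, Polynomial.eval_C,
      Polynomial.eval_X, hceval _ _ _ (hγ x), hq, eval_detPoly,
      Fin.sum_univ_three]
    ring
  have hgx : ∀ x, ‖g x‖ₑ = ‖p.eval (circlePt x)‖ₑ * ‖q.eval (circlePt x)‖ₑ⁻¹ := by
    intro x
    have h3 : ‖q.eval (circlePt x)‖ₑ ≠ 0 := by simpa using hqx x
    rw [hpx, enorm_mul, mul_comm ‖q.eval _‖ₑ, mul_assoc, ENNReal.mul_inv_cancel h3 enorm_ne_top,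
      mul_one]
  have hmeas : ∀ f : Polynomial ℂ, Measurable fun x => ‖f.eval (circlePt x)‖ₑ := fun f =>
    (f.continuous.measurable.comp continuous_circlePt.measurable).enorm
  by_cases hp0 : p = 0
  · have : ∀ x, ‖g x‖ₑ = 0 := fun x => by rw [hgx, hp0]; simp
    simp only [hg] at this
    simp [this, ENNReal.zero_rpow_of_pos hr0]
  obtain ⟨N, hN, hle, hint⟩ := h p hp0 hpd
  have hqq0 : q * q' ≠ 0 := by
    intro h0
    have := congrArg (Polynomial.eval 0) h0
    simp [hq, hq', eval_zero_detPoly] at this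
  obtain ⟨N', hN', hle', hint'⟩ := h (q * q') hqq0 (Polynomial.natDegree_mul_le.trans (by omega))
  have hN1 : 1 ≤ N' := by
    have := hle' 0 (by simp)
    simpa [hq, hq', eval_zero_detPoly] using this
  have hint1 : ∫⁻ x, ‖(q * q').eval (circlePt x)‖ₑ ^ (-r) ∂uniformAngle ≤ K := by
    refine hint'.trans (mul_le_of_le_one_left zero_le ?_)
    have := ennreal_rpow_neg_le hr0.le (ENNReal.one_le_ofReal.2 hN1)
    rwa [ENNReal.one_rpow] at this
  have hNr0 : ENNReal.ofReal N ^ r ≠ 0 := by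
    simp [hN]
  have hNr : ENNReal.ofReal N ^ r ≠ ⊤ := ENNReal.rpow_ne_top_of_nonneg hr0.le ENNReal.ofReal_ne_top
  -- The numerator is replaced by its bound `N`; the two denominators together form a polynomial of
  -- degree at most six.
  have hupper : ∫⁻ x, ‖1 - ζ * circlePt x ^ 3‖ₑ ^ (-r) * ‖g x‖ₑ ^ r ∂uniformAngle
      ≤ ENNReal.ofReal N ^ r * K := by
    refine le_trans (lintegral_mono (g := fun x => ENNReal.ofReal N ^ r *
      ‖(q * q').eval (circlePt x)‖ₑ ^ (-r)) fun x => ?_) ?_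
    · have h1 : ‖p.eval (circlePt x)‖ₑ ≤ ENNReal.ofReal N := by
        rw [← ofReal_norm]
        exact ENNReal.ofReal_le_ofReal (hle _ (norm_circlePt x).le)
      have h2 : q'.eval (circlePt x) = 1 - ζ * circlePt x ^ 3 := by simp [hq']
      simp only
      rw [Polynomial.eval_mul, h2, enorm_mul, hgx, ENNReal.mul_rpow_of_nonneg _ _ hr0.le,
        ENNReal.inv_rpow, ← ENNReal.rpow_neg,
        ENNReal.mul_rpow_of_ne_top enorm_ne_top enorm_ne_top]
      calc _ = ‖p.eval (circlePt x)‖ₑ ^ r * (‖q.eval (circlePt x)‖ₑ ^ (-r) *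
            ‖1 - ζ * circlePt x ^ 3‖ₑ ^ (-r)) := by ring
        _ ≤ _ := by gcongr
    · rw [lintegral_const_mul' _ _ hNr]
      gcongr
  -- Conversely, the negative moment of `p` forces its positive moment to be comparable to `N ^ r`,
  -- so the loss in `hupper` is only a constant.
  have hlower : ENNReal.ofReal N ^ r ≤ 48 ^ r * (K + 1) * ∫⁻ x, ‖g x‖ₑ ^ r ∂uniformAngle := by
    set f : ℝ → ℝ≥0∞ := fun x => (ENNReal.ofReal N ^ r)⁻¹ * ‖p.eval (circlePt x)‖ₑ ^ r with hf
    have hfm : Measurable f := ((hmeas p).pow_const r).const_mul _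
    have hfi : ∫⁻ x, (f x)⁻¹ ∂uniformAngle ≤ K + 1 := by
      have h1 : ∀ x, (f x)⁻¹ = ENNReal.ofReal N ^ r * ‖p.eval (circlePt x)‖ₑ ^ (-r) := by
        intro x
        rw [hf]
        simp only
        rw [ENNReal.mul_inv (Or.inl (ENNReal.inv_ne_zero.2 hNr))
          (Or.inl (ENNReal.inv_ne_top.2 hNr0)), inv_inv, ENNReal.rpow_neg]
      simp only [h1]
      rw [lintegral_const_mul' _ _ hNr]
      calc _ ≤ ENNReal.ofReal N ^ r * (ENNReal.ofReal N ^ (-r) * K) := by gcongr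
        _ = K := by
          rw [← mul_assoc, ENNReal.rpow_neg, ENNReal.mul_inv_cancel hNr0 hNr, one_mul]
        _ ≤ K + 1 := le_self_add
    have h2 := one_le_mul_lintegral hfm (by simp) (by finiteness) hfi
    rw [hf, lintegral_const_mul' _ _ (ENNReal.inv_ne_top.2 hNr0), mul_left_comm] at h2
    have h3 : ENNReal.ofReal N ^ r ≤ (K + 1) * ∫⁻ x, ‖p.eval (circlePt x)‖ₑ ^ r ∂uniformAngle := by
      calc ENNReal.ofReal N ^ r = ENNReal.ofReal N ^ r * 1 := (mul_one _).symm
        _ ≤ ENNReal.ofReal N ^ r * ((ENNReal.ofReal N ^ r)⁻¹ * _) := by gcongr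
        _ = _ := by rw [← mul_assoc, ENNReal.mul_inv_cancel hNr0 hNr, one_mul]
    refine h3.trans ?_
    rw [mul_comm (48 ^ r), mul_assoc]
    gcongr
    rw [← lintegral_const_mul' _ _ (by finiteness)]
    refine lintegral_mono fun x => ?_
    simp only
    rw [hpx, enorm_mul, ENNReal.mul_rpow_of_nonneg _ _ hr0.le]
    gcongr
    rw [← ofReal_norm, hq, eval_detPoly]
    refine (ENNReal.ofReal_le_ofReal
      (norm_det_le (norm_one_sub_smul_apply_le hB (norm_circlePt x).le))).trans ?_
    norm_num
  calc _ ≤ ENNReal.ofReal N ^ r * K := hupper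
    _ ≤ 48 ^ r * (K + 1) * (∫⁻ x, ‖g x‖ₑ ^ r ∂uniformAngle) * K := by gcongr
    _ = _ := by ring

/-! ### Averaging over one phase -/

/-- Resampling one of a family of independent random variables. -/
theorem lintegral_resample {ι Ω : Type*} [DecidableEq ι] [MeasurableSpace Ω] {P : Measure Ω}
    [IsProbabilityMeasure P] {X : ι → Ω → ℝ} (hX : ∀ i, Measurable (X i)) (hind : iIndepFun X P)
    (a : ι) {f : (ι → ℝ) → ℝ≥0∞} (hf : Measurable f) :
    ∫⁻ ω, f (fun i => X i ω) ∂P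
      = ∫⁻ ω, ∫⁻ t, f (Function.update (fun i => X i ω) a t) ∂(P.map (X a)) ∂P := by
  -- Freezing coordinate `a` makes `Y` a function of the other variables, hence independent of `X
  -- a`; Fubini then applies.
  set Y : Ω → ι → ℝ := fun ω => Function.update (fun i => X i ω) a 0 with hY
  have hYm : Measurable Y := by
    rw [measurable_pi_iff]
    intro i
    by_cases h : i = a
    · subst h
      simp [hY]
    · simpa [hY, Function.update_of_ne h] using hX i
  have hYX : IndepFun Y (X a) P := by
    have h1 : Indep (⨆ i ∈ ({a}ᶜ : Set ι), MeasurableSpace.comap (X i) inferInstance)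
        (⨆ i ∈ ({a} : Set ι), MeasurableSpace.comap (X i) inferInstance) P :=
      indep_iSup_of_disjoint (fun i => (hX i).comap_le) hind.iIndep disjoint_compl_left
    rw [IndepFun_iff_Indep]
    refine indep_of_indep_of_le_left (indep_of_indep_of_le_right h1 ?_) ?_
    · simp
    · refine @Measurable.comap_le _ _ (_) _ _ (@measurable_pi_iff _ _ _ (_) _ _ |>.2 fun i => ?_)
      by_cases h : i = a
      · subst h
        simp [hY]
      · simp only [hY, Function.update_of_ne h]
        refine Measurable.mono (comap_measurable (X i)) ?_ le_rfl
        exact le_iSup₂_of_le i h le_rfl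
  have hprod := (indepFun_iff_map_prod_eq_prod_map_map hYm.aemeasurable (hX a).aemeasurable).1 hYX
  set F : (ι → ℝ) × ℝ → ℝ≥0∞ := fun p => f (Function.update p.1 a p.2) with hF
  have hFm : Measurable F := by
    refine hf.comp ?_
    rw [measurable_pi_iff]
    intro i
    by_cases h : i = a
    · subst h
      simpa using measurable_snd
    · simpa [Function.update_of_ne h] using (measurable_pi_apply i).fun_comp measurable_fst
  have := Measure.isProbabilityMeasure_map (μ := P) hYm.aemeasurable
  have := Measure.isProbabilityMeasure_map (μ := P) (hX a).aemeasurable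
  calc ∫⁻ ω, f (fun i => X i ω) ∂P = ∫⁻ ω, F (Y ω, X a ω) ∂P := by
        refine lintegral_congr fun ω => ?_
        simp [hF, hY]
    _ = ∫⁻ p, F p ∂(P.map fun ω => (Y ω, X a ω)) :=
        (lintegral_map hFm (hYm.prodMk (hX a))).symm
    _ = ∫⁻ y, ∫⁻ t, F (y, t) ∂(P.map (X a)) ∂(P.map Y) := by
        rw [hprod, lintegral_prod _ hFm.aemeasurable]
    _ = ∫⁻ ω, ∫⁻ t, F (Y ω, t) ∂(P.map (X a)) ∂P :=
        lintegral_map hFm.lintegral_prod_right' hYm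
    _ = _ := by
        simp [hF, hY]

theorem phases_update (θ : Site → ℝ) (a : Site) (t : ℝ) :
    phases (Function.update θ a t) = Function.update (phases θ) a (circlePt t) := by
  funext x
  by_cases h : x = a
  · subst h
    simp [phases, circlePt]
  · simp [phases, Function.update_of_ne h]

theorem measurable_phases : Measurable phases := by
  rw [measurable_pi_iff]
  intro x
  unfold phases
  fun_prop

theorem norm_update_le {d : Site → ℂ} (hd : ∀ x, ‖d x‖ ≤ 1) (a : Site) {w : ℂ} (hw : ‖w‖ ≤ 1)
    (x : Site) : ‖Function.update d a w x‖ ≤ 1 := by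
  by_cases h : x = a
  · subst h
    simpa using hw
  · simpa [Function.update_of_ne h] using hd x

/-! ### Dependence of the resolvent on the weight at one site -/

section RankThree

variable {C : Matrix (Fin 3) (Fin 3) ℂ} {z : ℂ}

/-- The block at `a` of the resolvent with the weight at `a` removed. -/
noncomputable def block (C : Matrix (Fin 3) (Fin 3) ℂ) (z : ℂ) (d : Site → ℂ) (a : Site) :
    Matrix (Fin 3) (Fin 3) ℂ :=
  Matrix.of fun i j => z * res C z (Function.update d a 0) (a, i) (a, j)

theorem norm_block_le (hC : C ∈ Matrix.unitaryGroup (Fin 3) ℂ) (hz : ‖z‖ < 1) (d : Site → ℂ)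
    (a : Site) (i j : Fin 3) : ‖block C z d a i j‖ ≤ 1 := by
  rw [block, Matrix.of_apply, norm_mul]
  exact mul_le_one₀ hz.le (norm_nonneg _)
    (norm_res_le_one hC hz (Function.update_self ..) (Function.update_self ..))

/-- For `p` at `a` this is the system (1 - wB)γ = ρ for the row at `a`; for other `p` it gives the
entry as an affine function of w times that row. -/
theorem res_update_eq (hC : C ∈ Matrix.unitaryGroup (Fin 3) ℂ) (hz : ‖z‖ < 1) {d : Site → ℂ}
    (hd : ∀ x, ‖d x‖ ≤ 1) (a : Site) {w : ℂ} (hw : ‖w‖ ≤ 1) (p q : Site × Fin 3) :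
    res C z (Function.update d a w) p q = res C z (Function.update d a 0) p q +
      w * ∑ i, z * res C z (Function.update d a 0) p (a, i) *
        res C z (Function.update d a w) (a, i) q := by
  have h := res_sub_res hC hz (norm_update_le hd a hw)
    (norm_update_le hd a (w := 0) (by simp)) (a := a)
    (fun x hx => by simp [Function.update_of_ne hx]) p q
  rw [Function.update_self, Function.update_self, sub_zero] at h
  simp only [Fin.sum_univ_three] at h ⊢
  linear_combination h

/-- The resolvent identity with the two weights exchanged; it governs columns at `a`, with the
transposed block. -/
theorem res_update_eq' (hC : C ∈ Matrix.unitaryGroup (Fin 3) ℂ) (hz : ‖z‖ < 1) {d : Site → ℂ}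
    (hd : ∀ x, ‖d x‖ ≤ 1) (a : Site) {w : ℂ} (hw : ‖w‖ ≤ 1) (p q : Site × Fin 3) :
    res C z (Function.update d a w) p q = res C z (Function.update d a 0) p q +
      w * ∑ i, z * res C z (Function.update d a 0) (a, i) q *
        res C z (Function.update d a w) p (a, i) := by
  have h := res_sub_res hC hz (norm_update_le hd a (w := 0) (by simp)) (norm_update_le hd a hw)
    (a := a) (fun x hx => by simp [Function.update_of_ne hx]) p q
  rw [Function.update_self, Function.update_self, zero_sub] at h
  simp only [Fin.sum_univ_three] at h ⊢
  linear_combination -h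

/-- The resolvent with weight w at `a` exists, and its block supplies the inverse. -/
theorem det_one_sub_block_ne_zero (hC : C ∈ Matrix.unitaryGroup (Fin 3) ℂ) (hz : ‖z‖ < 1)
    {d : Site → ℂ} (hd : ∀ x, ‖d x‖ ≤ 1) (a : Site) {w : ℂ} (hw : ‖w‖ ≤ 1) :
    (1 - w • block C z d a).det ≠ 0 := by
  refine det_one_sub_smul_ne_zero
    (G := Matrix.of fun i j => z * res C z (Function.update d a w) (a, i) (a, j)) ?_
  ext i j
  simp only [Matrix.of_apply, Matrix.add_apply, Matrix.smul_apply, smul_eq_mul, Matrix.mul_apply,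
    block, Fin.sum_univ_three]
  have h := res_update_eq hC hz hd a hw (a, i) (a, j)
  simp only [Fin.sum_univ_three] at h
  linear_combination z * h

/-- Average over the phase at `a` of an entry of the resolvent in a row at `a`. -/
theorem exists_lintegral_res_row_le {t : ℝ} (ht0 : 0 < t) (ht : t < 1 / 3) :
    ∃ K : ℝ≥0∞, K ≠ ⊤ ∧ ∀ (C : Matrix (Fin 3) (Fin 3) ℂ), C ∈ Matrix.unitaryGroup (Fin 3) ℂ →
      ∀ z : ℂ, ‖z‖ < 1 → ∀ d : Site → ℂ, (∀ x, ‖d x‖ ≤ 1) → ∀ a i q,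
      ∫⁻ x, ‖res C z (Function.update d a (circlePt x)) (a, i) q‖ₑ ^ t ∂uniformAngle
        ≤ K * (∑ j, ‖res C z (Function.update d a 0) (a, j) q‖ₑ) ^ t := by
  obtain ⟨K, hK, h⟩ := exists_lintegral_solution_le ht0 ht
  refine ⟨K, hK, fun C hC z hz d hd a i q => ?_⟩
  exact h (block C z d a) (norm_block_le hC hz d a)
    (fun x => det_one_sub_block_ne_zero hC hz hd a (norm_circlePt x).le)
    (fun x i => res C z (Function.update d a (circlePt x)) (a, i) q)
    (fun i => res C z (Function.update d a 0) (a, i) q)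
    (fun x i => res_update_eq hC hz hd a (norm_circlePt x).le (a, i) q) i

/-- Average over the phase at `a` of an entry of the resolvent in a column at `a`. -/
theorem exists_lintegral_res_col_le {t : ℝ} (ht0 : 0 < t) (ht : t < 1 / 3) :
    ∃ K : ℝ≥0∞, K ≠ ⊤ ∧ ∀ (C : Matrix (Fin 3) (Fin 3) ℂ), C ∈ Matrix.unitaryGroup (Fin 3) ℂ →
      ∀ z : ℂ, ‖z‖ < 1 → ∀ d : Site → ℂ, (∀ x, ‖d x‖ ≤ 1) → ∀ a i p,
      ∫⁻ x, ‖res C z (Function.update d a (circlePt x)) p (a, i)‖ₑ ^ t ∂uniformAngle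
        ≤ K * (∑ j, ‖res C z (Function.update d a 0) p (a, j)‖ₑ) ^ t := by
  obtain ⟨K, hK, h⟩ := exists_lintegral_solution_le ht0 ht
  refine ⟨K, hK, fun C hC z hz d hd a i p => ?_⟩
  refine h (block C z d a).transpose (fun i j => norm_block_le hC hz d a j i) (fun x => ?_)
    (fun x i => res C z (Function.update d a (circlePt x)) p (a, i))
    (fun i => res C z (Function.update d a 0) p (a, i))
    (fun x i => res_update_eq' hC hz hd a (norm_circlePt x).le p (a, i)) i
  rw [← Matrix.transpose_smul, ← Matrix.transpose_one, ← Matrix.transpose_sub,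
    Matrix.det_transpose]
  exact det_one_sub_block_ne_zero hC hz hd a (norm_circlePt x).le

theorem sum_enorm_res_rpow_le (hC : C ∈ Matrix.unitaryGroup (Fin 3) ℂ) (hz : ‖z‖ < 1)
    {d : Site → ℂ} {x : Site} {q : Site × Fin 3} (hx : d x = 0) (hq : d q.1 = 0) :
    ∑ j, ‖res C z d (x, j) q‖ₑ ≤ 3 := by
  have h : ∀ j ∈ Finset.univ, ‖res C z d (x, j) q‖ₑ ≤ 1 := by
    intro j _
    rw [← ofReal_norm]
    exact ENNReal.ofReal_le_one.2 (norm_res_le_one hC hz hx hq)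
  refine (Finset.sum_le_sum h).trans ?_
  simp

end RankThree

/-! ### A priori bound and decoupling for the random resolvent -/

theorem sum_rpow_le_sum_rpow {ι : Type*} (s : Finset ι) (f : ι → ℝ≥0∞) {t : ℝ} (ht0 : 0 < t)
    (ht1 : t ≤ 1) : (∑ i ∈ s, f i) ^ t ≤ ∑ i ∈ s, f i ^ t := by
  classical
  induction s using Finset.induction_on with
  | empty => simp [ht0]
  | insert a s ha ih =>
    rw [Finset.sum_insert ha, Finset.sum_insert ha]
    exact (ENNReal.rpow_add_le_add_rpow _ _ ht0.le ht1).trans (by gcongr)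

theorem measurable_res_phases {C : Matrix (Fin 3) (Fin 3) ℂ}
    (hC : C ∈ Matrix.unitaryGroup (Fin 3) ℂ) {z : ℂ} (hz : ‖z‖ < 1) (p q : Site × Fin 3) :
    Measurable fun θ : Site → ℝ => res C z (phases θ) p q :=
  (measurable_res hC hz p q).comp measurable_phases

theorem measurable_res_phases_update {C : Matrix (Fin 3) (Fin 3) ℂ}
    (hC : C ∈ Matrix.unitaryGroup (Fin 3) ℂ) {z : ℂ} (hz : ‖z‖ < 1) (a : Site) (w : ℂ)
    (p q : Site × Fin 3) :
    Measurable fun θ : Site → ℝ => res C z (Function.update (phases θ) a w) p q :=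
  (measurable_res hC hz p q).comp (measurable_update_left.comp measurable_phases)

/-- The phases are independent and uniformly distributed on `[0, 2π)`. -/
structure IIDPhases {Ω : Type*} [MeasurableSpace Ω] (P : Measure Ω) (ω : Site → Ω → ℝ) : Prop where
  measurable : ∀ x, Measurable (ω x)
  indep : iIndepFun ω P
  map_eq : ∀ x, P.map (ω x) = uniformAngle

theorem IIDPhases.resample {Ω : Type*} [MeasurableSpace Ω] {P : Measure Ω} [IsProbabilityMeasure P]
    {ω : Site → Ω → ℝ} (h : IIDPhases P ω) (a : Site) {f : (Site → ℝ) → ℝ≥0∞} (hf : Measurable f) :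
    ∫⁻ o, f (fun x => ω x o) ∂P
      = ∫⁻ o, ∫⁻ t, f (Function.update (fun x => ω x o) a t) ∂uniformAngle ∂P := by
  rw [lintegral_resample h.measurable h.indep a hf, h.map_eq a]

/-- The a priori bound for fractional moments of order less than `1/3`. -/
theorem exists_lintegral_res_le.{u} {t : ℝ} (ht0 : 0 < t) (ht : t < 1 / 3) :
    ∃ K : ℝ≥0∞, K ≠ ⊤ ∧ ∀ (Ω : Type u) [MeasurableSpace Ω] (P : Measure Ω) [IsProbabilityMeasure P]
      (ω : Site → Ω → ℝ), IIDPhases P ω →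
      ∀ C ∈ Matrix.unitaryGroup (Fin 3) ℂ, ∀ z : ℂ, ‖z‖ < 1 → ∀ p q,
      ∫⁻ o, ‖res C z (phases fun x => ω x o) p q‖ₑ ^ t ∂P ≤ K := by
  obtain ⟨K₁, hK₁, hrow⟩ := exists_lintegral_res_row_le ht0 ht
  obtain ⟨K₂, hK₂, hcol⟩ := exists_lintegral_res_col_le ht0 ht
  -- The first term serves x = y, where one average suffices; the second serves x ≠ y, where both
  -- phases are averaged.
  refine ⟨K₁ * 3 ^ t + K₁ * (3 * (K₂ * 3 ^ t)), by finiteness, ?_⟩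
  intro Ω _ P _ ω hω C hC z hz p q
  obtain ⟨x, i⟩ := p
  obtain ⟨y, k⟩ := q
  have hphase : ∀ θ x, ‖phases θ x‖ ≤ 1 := fun θ x => (norm_phases θ x).le
  rw [hω.resample x (f := fun θ => ‖res C z (phases θ) (x, i) (y, k)‖ₑ ^ t)
    ((measurable_res_phases hC hz _ _).enorm.pow_const t)]
  simp only [phases_update]
  have h1 := fun θ => hrow C hC z hz (phases θ) (hphase θ) x i (y, k)
  refine (lintegral_mono fun o => h1 _).trans ?_
  by_cases hxy : x = y
  · subst hxy
    refine le_trans (lintegral_mono (g := fun _ => K₁ * 3 ^ t) fun o => ?_) (by simp)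
    refine mul_le_mul_right (ENNReal.rpow_le_rpow ?_ ht0.le) _
    exact sum_enorm_res_rpow_le hC hz (Function.update_self ..) (Function.update_self ..)
  · rw [lintegral_const_mul' _ _ hK₁]
    refine le_trans ?_ le_add_self
    gcongr
    rw [hω.resample y (f := fun θ =>
      (∑ j, ‖res C z (Function.update (phases θ) x 0) (x, j) (y, k)‖ₑ) ^ t)
      ((Finset.measurable_sum _ fun j _ =>
        (measurable_res_phases_update hC hz _ _ _ _).enorm).pow_const t)]
    refine le_trans (lintegral_mono (g := fun _ => 3 * (K₂ * 3 ^ t)) fun o => ?_) (by simp)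
    simp only [phases_update, Function.update_comm (Ne.symm hxy)]
    set d := Function.update (phases fun x => ω x o) x 0 with hd
    have hd1 : ∀ x, ‖d x‖ ≤ 1 := norm_update_le (hphase _) x (by simp)
    have hm : ∀ j, Measurable fun s =>
        ‖res C z (Function.update d y (circlePt s)) (x, j) (y, k)‖ₑ ^ t := fun j =>
      (((measurable_res hC hz _ _).comp ((measurable_update d).comp
        continuous_circlePt.measurable)).enorm.pow_const t)
    calc _ ≤ ∫⁻ s, ∑ j, ‖res C z (Function.update d y (circlePt s)) (x, j) (y, k)‖ₑ ^ t
          ∂uniformAngle := lintegral_mono fun s => sum_rpow_le_sum_rpow _ _ ht0 (by linarith)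
      _ = ∑ j, ∫⁻ s, ‖res C z (Function.update d y (circlePt s)) (x, j) (y, k)‖ₑ ^ t
          ∂uniformAngle := lintegral_finsetSum _ fun j _ => hm j
      _ ≤ ∑ j : Fin 3, K₂ * 3 ^ t := by
          refine Finset.sum_le_sum fun j _ => (hcol C hC z hz d hd1 y k (x, j)).trans ?_
          gcongr
          -- Now both weights are removed, so the deterministic bound applies.
          have h2 : ∀ l ∈ Finset.univ,
              ‖res C z (Function.update d y 0) (x, j) (y, l)‖ₑ ≤ 1 := by
            intro l _
            rw [← ofReal_norm]
            refine ENNReal.ofReal_le_one.2 (norm_res_le_one hC hz ?_ (Function.update_self ..))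
            rw [Function.update_of_ne hxy, hd, Function.update_self]
          exact (Finset.sum_le_sum h2).trans (by simp)
      _ = _ := by simp

/-- Decoupling for the resolvent. -/
theorem exists_lintegral_res_decouple_le.{u} {r : ℝ} (hr0 : 0 < r) (hr : r < 1 / 6) :
    ∃ K : ℝ≥0∞, K ≠ ⊤ ∧ ∀ (Ω : Type u) [MeasurableSpace Ω] (P : Measure Ω) [IsProbabilityMeasure P]
      (ω : Site → Ω → ℝ), IIDPhases P ω →
      ∀ C ∈ Matrix.unitaryGroup (Fin 3) ℂ, ∀ z : ℂ, ‖z‖ < 1 → ∀ p q,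
      ∀ (a : Site) (ζ : (Site → ℝ) → ℂ), Measurable ζ →
      (∀ θ t, ζ (Function.update θ a t) = ζ θ) →
      ∫⁻ o, ‖1 - ζ (fun x => ω x o) * phases (fun x => ω x o) a ^ 3‖ₑ ^ (-r) *
          ‖res C z (phases fun x => ω x o) p q‖ₑ ^ r ∂P
        ≤ K * ∫⁻ o, ‖res C z (phases fun x => ω x o) p q‖ₑ ^ r ∂P := by
  obtain ⟨K, hK, h⟩ := exists_lintegral_decouple_le hr0 hr
  refine ⟨K, hK, fun Ω _ P _ ω hω C hC z hz p q a ζ hζ hζa => ?_⟩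
  have hm := (measurable_res_phases hC hz p q).enorm.pow_const r
  have hm' : Measurable fun θ => ‖1 - ζ θ * phases θ a ^ 3‖ₑ ^ (-r) := by
    have := (measurable_pi_apply a).comp measurable_phases
    exact (measurable_const.sub (hζ.mul (this.pow_const 3))).enorm.pow_const _
  rw [hω.resample a (f := fun θ => ‖1 - ζ θ * phases θ a ^ 3‖ₑ ^ (-r) *
    ‖res C z (phases θ) p q‖ₑ ^ r) (hm'.mul hm),
    hω.resample a (f := fun θ => ‖res C z (phases θ) p q‖ₑ ^ r) hm,
    ← lintegral_const_mul' _ _ hK]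
  refine lintegral_mono fun o => ?_
  simp only [phases_update, hζa, Function.update_self]
  set d := phases fun x => ω x o with hd
  have hd1 : ∀ x, ‖d x‖ ≤ 1 := fun x => (norm_phases _ x).le
  have h1 := h (block C z d a) (norm_block_le hC hz d a)
    (fun x => det_one_sub_block_ne_zero hC hz hd1 a (norm_circlePt x).le)
    (fun x i => res C z (Function.update d a (circlePt x)) (a, i) q)
    (fun i => res C z (Function.update d a 0) (a, i) q)
    (fun x i => res_update_eq hC hz hd1 a (norm_circlePt x).le (a, i) q)
    (ζ fun x => ω x o) (res C z (Function.update d a 0) p q)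
    (fun j => z * res C z (Function.update d a 0) p (a, j))
  simp only [← res_update_eq hC hz hd1 a (norm_circlePt _).le p q] at h1
  exact h1

/-! ### Stars, and one turn around them -/

/-- One step of the backwards walk with coin `C₀`. -/
def prev (p : Site × Fin 3) : Site × Fin 3 := (hopInv p.2 p.1, p.2 + 1)

theorem prev_iterate_six (p : Site × Fin 3) : prev^[6] p = p := by
  obtain ⟨x, i⟩ := p
  fin_cases i <;> cases x <;> simp [prev, hopInv, Function.iterate_succ_apply]

/-- The orbits of the walk with coin `C₀` are stars, whose centre is visited three times. -/
theorem exists_center (p : Site × Fin 3) : ∃ (a : Site) (s : Fin 3 → Site), (∀ m, s m ≠ a) ∧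
    ∀ d : Site → ℂ, ∏ k ∈ Finset.range 6, d (prev^[k] p).1 = (∏ m, d (s m)) * d a ^ 3 := by
  obtain ⟨x, i⟩ := p
  cases x with
  | A j k =>
    -- Centres are `A` sites: an orbit alternates between its centre and the leaves, so the parity
    -- of the leaf positions depends on the type of the starting site.
    refine ⟨.A j k, fun m => (prev^[2 * m + 1] (.A j k, i)).1, ?_, fun d => ?_⟩
    · intro m
      fin_cases i <;> fin_cases m <;> simp [prev, hopInv, Function.iterate_succ_apply]
    · fin_cases i <;>
        simp [prev, hopInv, Function.iterate_succ_apply, Finset.prod_range_succ,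
          Fin.prod_univ_three] <;> ring
  | B j k =>
    refine ⟨(prev (.B j k, i)).1, fun m => (prev^[2 * m] (.B j k, i)).1, ?_, fun d => ?_⟩
    · intro m
      fin_cases i <;> fin_cases m <;> simp [prev, hopInv, Function.iterate_succ_apply]
    · fin_cases i <;>
        simp [prev, hopInv, Function.iterate_succ_apply, Finset.prod_range_succ,
          Fin.prod_univ_three] <;> ring

/-- `SimpleGraph.dist` is 0 between different components, so no connectedness is needed. -/
theorem dist_le_dist_add_one {V : Type*} {G : SimpleGraph V} {x x' y : V} (h : G.Adj x x') :
    G.dist x y ≤ G.dist x' y + 1 := by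
  by_cases hr : G.Reachable x' y
  · obtain ⟨w, hw⟩ := hr.exists_walk_length_eq_dist
    rw [← hw]
    exact SimpleGraph.dist_le (SimpleGraph.Walk.cons h w)
  · have : ¬ G.Reachable x y := fun h' => hr (h.reachable.symm.trans h')
    rw [SimpleGraph.dist_eq_zero_of_not_reachable this]
    exact Nat.zero_le _

theorem dist_prev_iterate (p : Site × Fin 3) (y : Site) (k : ℕ) :
    graph.dist p.1 y ≤ graph.dist (prev^[k] p).1 y + k := by
  induction k with
  | zero => simp
  | succ k ih =>
    have hadj : graph.Adj (prev^[k] p).1 (prev^[k + 1] p).1 := by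
      rw [Function.iterate_succ_apply']
      refine SimpleGraph.Adj.symm ⟨(prev^[k] p).2, ?_⟩
      rw [prev, hop_hopInv]
    have := dist_le_dist_add_one hadj (y := y)
    omega

theorem norm_sub_C₀_le {C : Matrix (Fin 3) (Fin 3) ℂ} {φ : ℝ} (h : maxNorm (C - C₀) ≤ φ)
    (i j : Fin 3) : ‖(C - C₀) i j‖ ≤ φ :=
  (le_ciSup (f := fun p : Fin 3 × Fin 3 => ‖(C - C₀) p.1 p.2‖) (Set.finite_range _).bddAbove
    (i, j)).trans h

theorem sum_C₀_mul (i : Fin 3) (v : Fin 3 → ℂ) : ∑ j, C₀ i j * v j = v (i + 1) := by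
  fin_cases i <;> simp [C₀, Fin.sum_univ_three]

/-- Solution of a first order linear recursion with contracting coefficients. -/
theorem exists_eq_prod_mul_add {g c e : ℕ → ℂ} (hc : ∀ k, ‖c k‖ ≤ 1) (n : ℕ)
    (h : ∀ k < n, g (k + 1) = c k * g k + e k) :
    ∃ E, g n = (∏ k ∈ Finset.range n, c k) * g 0 + E ∧ ‖E‖ ≤ ∑ k ∈ Finset.range n, ‖e k‖ := by
  induction n with
  | zero => exact ⟨0, by simp, by simp⟩
  | succ n ih =>
    obtain ⟨E, hE, hEn⟩ := ih fun k hk => h k (by omega)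
    refine ⟨c n * E + e n, ?_, ?_⟩
    · rw [h n (by omega), hE, Finset.prod_range_succ]
      ring
    · rw [Finset.sum_range_succ]
      refine (norm_add_le _ _).trans (add_le_add ?_ le_rfl)
      rw [norm_mul]
      exact (mul_le_of_le_one_left (norm_nonneg _) (hc n)).trans hEn

/-- Going once around a star bounds the resolvent by its values nearby. -/
theorem norm_one_sub_mul_norm_res_le {C : Matrix (Fin 3) (Fin 3) ℂ}
    (hC : C ∈ Matrix.unitaryGroup (Fin 3) ℂ) {φ : ℝ} (hφ : maxNorm (C - C₀) ≤ φ) {z : ℂ}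
    (hz : ‖z‖ < 1) {d : Site → ℂ} (hd : ∀ x, ‖d x‖ ≤ 1) {p q : Site × Fin 3}
    (hpq : 6 ≤ graph.dist p.1 q.1) :
    ‖1 - z ^ 6 * ∏ k ∈ Finset.range 6, d (prev^[k] p).1‖ * ‖res C z d p q‖
      ≤ φ * ∑ k ∈ Finset.range 6, ∑ j, ‖res C z d ((prev^[k + 1] p).1, j) q‖ := by
  set e : ℕ → ℂ := fun k => -∑ j, (C - C₀) (prev^[k] p).2 j *
    res C z d ((prev^[k + 1] p).1, j) q with he
  obtain ⟨E, hE, hEn⟩ := exists_eq_prod_mul_add (g := fun k => res C z d (prev^[k] p) q)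
    (c := fun k => z * d (prev^[k] p).1) (e := e)
    (fun k => by
      rw [norm_mul]
      exact mul_le_one₀ hz.le (norm_nonneg _) (hd _)) 6 (by
    intro k hk
    -- Fewer than six steps cannot reach the source, so the resolvent equation is homogeneous along
    -- the orbit.
    have hne : ((prev^[k] p).1, (prev^[k] p).2) ≠ q := by
      intro h
      have h1 := dist_prev_iterate p q.1 k
      rw [← h, SimpleGraph.dist_self, h] at h1
      omega
    have h1 := sum_coin_mul_res hC hz hd (prev^[k] p).1 (prev^[k] p).2 q
    rw [if_neg hne, add_zero] at h1
    have h2 := sum_C₀_mul (prev^[k] p).2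
      fun j => res C z d (hopInv (prev^[k] p).2 (prev^[k] p).1, j) q
    have h3 : (prev^[k + 1] p) = (hopInv (prev^[k] p).2 (prev^[k] p).1, (prev^[k] p).2 + 1) := by
      rw [Function.iterate_succ_apply', prev]
    rw [he]
    simp only [h3, Matrix.sub_apply, sub_mul, Finset.sum_sub_distrib, h2, h1]
    ring)
  -- The orbit closes after six steps, so the recursion becomes an equation for the initial entry
  -- alone.
  simp only [prev_iterate_six, Function.iterate_zero, id, Finset.prod_mul_distrib,
    Finset.prod_const, Finset.card_range] at hE
  rw [← norm_mul, sub_mul, one_mul]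
  rw [← sub_eq_iff_eq_add'] at hE
  rw [hE, Finset.mul_sum]
  refine hEn.trans (Finset.sum_le_sum fun k _ => ?_)
  rw [he, norm_neg, Finset.mul_sum]
  have hj : ∀ j ∈ Finset.univ, ‖(C - C₀) (prev^[k] p).2 j *
      res C z d ((prev^[k + 1] p).1, j) q‖ ≤ φ * ‖res C z d ((prev^[k + 1] p).1, j) q‖ := by
    intro j _
    rw [norm_mul]
    exact mul_le_mul_of_nonneg_right (norm_sub_C₀_le hφ _ _) (norm_nonneg _)
  exact norm_sum_le_of_le Finset.univ hj

/-- Far from the source, a fractional moment of the resolvent is bounded by the small factor `φʳ`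
times the fractional moments nearby. -/
theorem exists_lintegral_res_le_sum.{u} {r : ℝ} (hr0 : 0 < r) (hr : r < 1 / 6) :
    ∃ K : ℝ≥0∞, K ≠ ⊤ ∧ ∀ (Ω : Type u) [MeasurableSpace Ω] (P : Measure Ω) [IsProbabilityMeasure P]
      (ω : Site → Ω → ℝ), IIDPhases P ω → ∀ φ : ℝ,
      ∀ C ∈ Matrix.unitaryGroup (Fin 3) ℂ, maxNorm (C - C₀) ≤ φ → ∀ z : ℂ, ‖z‖ < 1 → ∀ p q,
      6 ≤ graph.dist p.1 q.1 →
      ∫⁻ o, ‖res C z (phases fun x => ω x o) p q‖ₑ ^ r ∂P ≤ ENNReal.ofReal φ ^ r * K *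
        ∑ k ∈ Finset.range 6, ∑ j,
          ∫⁻ o, ‖res C z (phases fun x => ω x o) ((prev^[k + 1] p).1, j) q‖ₑ ^ r ∂P := by
  obtain ⟨K, hK, h⟩ := exists_lintegral_res_decouple_le hr0 hr
  refine ⟨K, hK, fun Ω _ P _ ω hω φ C hC hφ z hz p q hpq => ?_⟩
  obtain ⟨a, s, hsa, hprod⟩ := exists_center p
  set ζ : (Site → ℝ) → ℂ := fun θ => z ^ 6 * ∏ m, phases θ (s m) with hζ
  have hζm : Measurable ζ := (Finset.measurable_prod _ fun m _ =>
    (measurable_pi_apply (s m)).comp measurable_phases).const_mul _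
  have hζa : ∀ θ t, ζ (Function.update θ a t) = ζ θ := by
    intro θ t
    simp only [hζ, phases_update, Function.update_of_ne (hsa _)]
  have hφ0 : 0 ≤ φ := (norm_nonneg _).trans (norm_sub_C₀_le hφ 0 0)
  set Z : Ω → ℝ≥0∞ := fun o => ‖1 - ζ (fun x => ω x o) * phases (fun x => ω x o) a ^ 3‖ₑ with hZ
  have hωm : Measurable fun o x => ω x o := measurable_pi_iff.2 hω.measurable
  have hZm : Measurable Z := by
    have := (measurable_pi_apply a).comp measurable_phases
    exact ((measurable_const.sub (hζm.mul (this.pow_const 3))).comp hωm).enorm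
  have hpt : ∀ o, ‖res C z (phases fun x => ω x o) p q‖ₑ ^ r ≤ ∑ k ∈ Finset.range 6, ∑ j,
      ENNReal.ofReal φ ^ r * (Z o ^ (-r) *
        ‖res C z (phases fun x => ω x o) ((prev^[k + 1] p).1, j) q‖ₑ ^ r) := by
    intro o
    have h1 := norm_one_sub_mul_norm_res_le hC hφ hz
      (fun x => (norm_phases (fun x => ω x o) x).le) hpq
    rw [hprod, ← mul_assoc] at h1
    -- All weights are unimodular, so the product subtracted from 1 has modulus |z|⁶ < 1.
    have hne : Z o ≠ 0 := by
      rw [hZ]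
      simp only [ne_eq, enorm_eq_zero]
      intro h0
      have h2 : ‖ζ (fun x => ω x o) * phases (fun x => ω x o) a ^ 3‖ = 1 := by
        rw [← sub_eq_zero.1 h0, norm_one]
      rw [hζ] at h2
      simp only [norm_mul, norm_pow, norm_prod, norm_phases, Finset.prod_const_one, mul_one,
        one_pow] at h2
      have := pow_lt_one₀ (norm_nonneg z) hz (by norm_num : 6 ≠ 0)
      linarith
    have h3 := ENNReal.ofReal_le_ofReal h1
    rw [ENNReal.ofReal_mul (norm_nonneg _), ENNReal.ofReal_mul hφ0,
      ENNReal.ofReal_sum_of_nonneg fun _ _ => Finset.sum_nonneg fun _ _ => norm_nonneg _] at h3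
    simp only [ENNReal.ofReal_sum_of_nonneg fun _ _ => norm_nonneg _, ofReal_norm] at h3
    rw [mul_comm, ← ENNReal.le_div_iff_mul_le (Or.inl hne) (Or.inl enorm_ne_top)] at h3
    refine (ENNReal.rpow_le_rpow h3 hr0.le).trans ?_
    rw [div_eq_mul_inv, ENNReal.mul_rpow_of_nonneg _ _ hr0.le, ENNReal.mul_rpow_of_nonneg _ _ hr0.le,
      ENNReal.inv_rpow, ← ENNReal.rpow_neg, mul_assoc, mul_comm (_ ^ r) (_ ^ (-r))]
    simp only [← Finset.mul_sum]
    gcongr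
    refine (sum_rpow_le_sum_rpow _ _ hr0 (by linarith)).trans ?_
    exact Finset.sum_le_sum fun k _ => sum_rpow_le_sum_rpow _ _ hr0 (by linarith)
  have hφr : ENNReal.ofReal φ ^ r ≠ ⊤ :=
    ENNReal.rpow_ne_top_of_nonneg hr0.le ENNReal.ofReal_ne_top
  have hm : ∀ k j, Measurable fun o => ENNReal.ofReal φ ^ r * (Z o ^ (-r) *
        ‖res C z (phases fun x => ω x o) ((prev^[k + 1] p).1, j) q‖ₑ ^ r) := fun k j =>
    ((hZm.pow_const _).mul
      (((measurable_res_phases hC hz _ _).comp hωm).enorm.pow_const r)).const_mul _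
  refine (lintegral_mono hpt).trans ?_
  rw [lintegral_finsetSum _ fun k _ => Finset.measurable_sum _ fun j _ => hm k j, Finset.mul_sum]
  refine Finset.sum_le_sum fun k _ => ?_
  rw [lintegral_finsetSum _ fun j _ => hm k j, Finset.mul_sum]
  refine Finset.sum_le_sum fun j _ => ?_
  rw [lintegral_const_mul' _ _ hφr, mul_assoc]
  gcongr
  exact h Ω P ω hω C hC z hz _ q a ζ hζm hζa

/-! ### Iteration and interpolation -/

/-- Iteration of the estimate `exists_lintegral_res_le_sum`. -/
theorem le_mul_pow_of_le_sum {I : Site × Fin 3 → ℝ≥0∞} {y : Site} {A ε δ : ℝ≥0∞}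
    (hA : ∀ p, I p ≤ A) (hδ : 18 * δ ≤ ε)
    (hI : ∀ p, 6 ≤ graph.dist p.1 y →
      I p ≤ δ * ∑ k ∈ Finset.range 6, ∑ j, I ((prev^[k + 1] p).1, j)) (n : ℕ) :
    ∀ p, 6 * n ≤ graph.dist p.1 y → I p ≤ A * ε ^ n := by
  induction n with
  | zero => intro p _; simpa using hA p
  | succ n ih =>
    intro p hp
    have h1 : ∀ k ∈ Finset.range 6, ∀ j : Fin 3, I ((prev^[k + 1] p).1, j) ≤ A * ε ^ n := by
      intro k hk j
      refine ih _ ?_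
      simp only
      -- At most six steps towards `y` are lost, hence one power of `ε` per six units of distance.
      have := dist_prev_iterate p y (k + 1)
      rw [Finset.mem_range] at hk
      omega
    calc I p ≤ δ * ∑ k ∈ Finset.range 6, ∑ j, I ((prev^[k + 1] p).1, j) := hI p (by omega)
      _ ≤ δ * ∑ k ∈ Finset.range 6, ∑ _j : Fin 3, A * ε ^ n := by
          gcongr with k hk j
          exact h1 k hk j
      _ = 18 * δ * (A * ε ^ n) := by
          simp only [Finset.sum_const, Finset.card_range, Finset.card_univ, Fintype.card_fin,
            nsmul_eq_mul]
          push_cast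
          ring
      _ ≤ ε * (A * ε ^ n) := by gcongr
      _ = A * ε ^ (n + 1) := by ring

/-- The first term dominates where X ≤ κ, the second where X ≥ κ. With `κ` free this replaces Hölder
interpolation. -/
theorem rpow_le_rpow_add_rpow {X κ : ℝ≥0∞} (hX : X ≠ ⊤) {r s t : ℝ} (hs : 0 < s)
    (hrs : r ≤ s) (hst : s ≤ t) : X ^ s ≤ κ ^ (s - r) * X ^ r + κ ^ (-(t - s)) * X ^ t := by
  by_cases h0 : X = 0
  · simp [h0, hs]
  rcases le_total X κ with h | h
  · refine le_trans ?_ le_self_add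
    calc X ^ s = X ^ (s - r) * X ^ r := by rw [← ENNReal.rpow_add _ _ h0 hX, sub_add_cancel]
      _ ≤ _ := by
        gcongr
  · refine le_trans ?_ le_add_self
    calc X ^ s = X ^ (-(t - s)) * X ^ t := by rw [← ENNReal.rpow_add _ _ h0 hX]; congr 1; ring
      _ ≤ _ := mul_le_mul_left (ennreal_rpow_neg_le (by linarith) h) _

theorem ofReal_exp_rpow (u v : ℝ) :
    ENNReal.ofReal (Real.exp u) ^ v = ENNReal.ofReal (Real.exp (u * v)) := by
  rw [ENNReal.ofReal_rpow_of_pos (Real.exp_pos _), ← Real.exp_mul]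

/-- Exponential decay of the fractional moments of the resolvent. -/
theorem exists_lintegral_res_le_exp.{u} {s : ℝ} (hs0 : 0 < s) (hs1 : s < 1 / 3) :
    ∃ φ : ℝ, 0 < φ ∧ ∃ c : ℝ, 0 < c ∧ ∃ g : ℝ, 0 < g ∧
      ∀ (Ω : Type u) [MeasurableSpace Ω] (P : Measure Ω) [IsProbabilityMeasure P]
        (ω : Site → Ω → ℝ), IIDPhases P ω →
        ∀ C ∈ Matrix.unitaryGroup (Fin 3) ℂ, maxNorm (C - C₀) ≤ φ → ∀ z : ℂ, ‖z‖ < 1 → ∀ p q,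
        ∫⁻ o, ‖res C z (phases fun x => ω x o) p q‖ₑ ^ s ∂P
          ≤ ENNReal.ofReal (c * Real.exp (-g * (graph.dist p.1 q.1 : ℝ))) := by
  set r : ℝ := s / 2 with hr
  set t : ℝ := (s + 1 / 3) / 2 with ht
  obtain ⟨A, hA, hAr⟩ := exists_lintegral_res_le.{u} (t := r) (by linarith) (by linarith)
  obtain ⟨B, hB, hBt⟩ := exists_lintegral_res_le.{u} (t := t) (by linarith) (by linarith)
  obtain ⟨K, hK, hstep⟩ := exists_lintegral_res_le_sum.{u} (r := r) (by linarith) (by linarith)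
  have hr0 : 0 < r := by linarith
  -- Chosen so that with φʳ = η each iteration gains a factor e⁻¹.
  set η : ℝ := Real.exp (-1) / (18 * (K.toReal + 1)) with hη
  have hK0 : 0 ≤ K.toReal := ENNReal.toReal_nonneg
  have hηpos : 0 < η := by positivity
  set φ : ℝ := η ^ r⁻¹ with hφ
  have hφpos : 0 < φ := Real.rpow_pos_of_pos hηpos _
  have hδ : 18 * (ENNReal.ofReal φ ^ r * K) ≤ ENNReal.ofReal (Real.exp (-1)) := by
    rw [ENNReal.ofReal_rpow_of_pos hφpos, hφ, Real.rpow_inv_rpow hηpos.le hr0.ne',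
      ← ENNReal.ofReal_toReal hK, ← ENNReal.ofReal_mul hηpos.le,
      show (18 : ℝ≥0∞) = ENNReal.ofReal 18 by norm_num, ← ENNReal.ofReal_mul (by norm_num)]
    refine ENNReal.ofReal_le_ofReal ?_
    rw [hη, div_mul_eq_mul_div, mul_div_assoc',
      div_le_iff₀ (by positivity)]
    nlinarith [Real.exp_pos (-1)]
  set g : ℝ := min (1 / 2) ((t - s) / s) with hg
  have hgpos : 0 < g := lt_min (by norm_num) (div_pos (by linarith) hs0)
  refine ⟨φ, hφpos, (A.toReal + B.toReal + 1) * Real.exp g, by positivity, g / 6, by positivity, ?_⟩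
  intro Ω _ P _ ω hω C hC hCφ z hz p q
  set n : ℕ := graph.dist p.1 q.1 / 6 with hn
  have hdecay := le_mul_pow_of_le_sum
    (I := fun p => ∫⁻ o, ‖res C z (phases fun x => ω x o) p q‖ₑ ^ r ∂P) (y := q.1)
    (fun p => hAr Ω P ω hω C hC z hz p q) hδ
    (fun p hp => hstep Ω P ω hω φ C hC hCφ z hz p q hp) n p (Nat.mul_div_le _ _)
  -- With s - r = s/2 the low moment costs e^(n/2), which its decay e^(-n) absorbs, while the high
  -- moment gains e^(-n(t-s)/s).
  set κ : ℝ≥0∞ := ENNReal.ofReal (Real.exp (n / s)) with hκ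
  have hκr : κ ^ (s - r) = ENNReal.ofReal (Real.exp (n / 2)) := by
    rw [hκ, ofReal_exp_rpow, hr]
    congr 2
    field_simp
    ring
  have hκt : κ ^ (-(t - s)) = ENNReal.ofReal (Real.exp (-((t - s) / s) * n)) := by
    rw [hκ, ofReal_exp_rpow]
    congr 2
    field_simp
  have hωm : Measurable fun o x => ω x o := measurable_pi_iff.2 hω.measurable
  have hm : Measurable fun o => ‖res C z (phases fun x => ω x o) p q‖ₑ :=
    ((measurable_res_phases hC hz p q).comp hωm).enorm
  have hn0 : (0 : ℝ) ≤ n := Nat.cast_nonneg n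
  calc ∫⁻ o, ‖res C z (phases fun x => ω x o) p q‖ₑ ^ s ∂P
      ≤ ∫⁻ o, (κ ^ (s - r) * ‖res C z (phases fun x => ω x o) p q‖ₑ ^ r +
          κ ^ (-(t - s)) * ‖res C z (phases fun x => ω x o) p q‖ₑ ^ t) ∂P :=
        lintegral_mono fun o =>
          rpow_le_rpow_add_rpow enorm_ne_top hs0 (by linarith) (by linarith)
    _ = κ ^ (s - r) * ∫⁻ o, ‖res C z (phases fun x => ω x o) p q‖ₑ ^ r ∂P +
          κ ^ (-(t - s)) * ∫⁻ o, ‖res C z (phases fun x => ω x o) p q‖ₑ ^ t ∂P := by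
        rw [lintegral_add_left ((hm.pow_const r).const_mul _),
          lintegral_const_mul _ (hm.pow_const r), lintegral_const_mul _ (hm.pow_const t)]
    _ ≤ ENNReal.ofReal (Real.exp (n / 2)) * (A * ENNReal.ofReal (Real.exp (-1)) ^ n) +
          ENNReal.ofReal (Real.exp (-((t - s) / s) * n)) * B := by
        rw [hκr, hκt]
        gcongr
        exact hBt Ω P ω hω C hC z hz p q
    _ = ENNReal.ofReal (A.toReal * Real.exp (-(1 / 2) * n) +
          B.toReal * Real.exp (-((t - s) / s) * n)) := by
        rw [ENNReal.ofReal_add (by positivity) (by positivity), ENNReal.ofReal_mul (by positivity),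
          ENNReal.ofReal_mul (by positivity), ENNReal.ofReal_toReal hA, ENNReal.ofReal_toReal hB,
          mul_left_comm, ← ENNReal.ofReal_pow (Real.exp_pos _).le, ← Real.exp_nat_mul,
          ← ENNReal.ofReal_mul (Real.exp_pos _).le, ← Real.exp_add, mul_comm _ B]
        congr 4
        ring
    _ ≤ _ := by
        refine ENNReal.ofReal_le_ofReal ?_
        have hD : (graph.dist p.1 q.1 : ℝ) ≤ 6 * n + 6 := by
          have : graph.dist p.1 q.1 ≤ 6 * n + 6 := by omega
          exact_mod_cast this
        have h1 : Real.exp (-g * n) ≤ Real.exp g * Real.exp (-(g / 6) * (graph.dist p.1 q.1 : ℝ)) := by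
          rw [← Real.exp_add]
          refine Real.exp_le_exp.2 ?_
          nlinarith
        have h2 : Real.exp (-(1 / 2) * n) ≤ Real.exp (-g * n) := by
          refine Real.exp_le_exp.2 ?_
          nlinarith [min_le_left (1 / 2 : ℝ) ((t - s) / s)]
        have h3 : Real.exp (-((t - s) / s) * n) ≤ Real.exp (-g * n) := by
          refine Real.exp_le_exp.2 ?_
          nlinarith [min_le_right (1 / 2 : ℝ) ((t - s) / s)]
        have hA0 : 0 ≤ A.toReal := ENNReal.toReal_nonneg
        have hB0 : 0 ≤ B.toReal := ENNReal.toReal_nonneg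
        calc A.toReal * Real.exp (-(1 / 2) * n) + B.toReal * Real.exp (-((t - s) / s) * n)
            ≤ A.toReal * Real.exp (-g * n) + B.toReal * Real.exp (-g * n) := by gcongr
          _ ≤ (A.toReal + B.toReal + 1) * Real.exp (-g * n) := by
              nlinarith [Real.exp_pos (-g * n)]
          _ ≤ (A.toReal + B.toReal + 1) *
              (Real.exp g * Real.exp (-(g / 6) * (graph.dist p.1 q.1 : ℝ))) := by gcongr
          _ = _ := by ring

end HexWalk

/-! ### Return to the Green function and to Bochner integrals -/

theorem mainTheorem1 (s : ℝ) (hs0 : 0 < s) (hs1 : s < 1 / 3) :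
    ∃ φ : ℝ, 0 < φ ∧ ∃ c : ℝ, 0 < c ∧ ∃ g : ℝ, 0 < g ∧
      ∀ (Ω : Type*) [MeasurableSpace Ω] (P : Measure Ω) [IsProbabilityMeasure P]
        (ω : HexWalk.Site → Ω → ℝ),
        (∀ x, Measurable (ω x)) → iIndepFun ω P →
        (∀ x, pdf.IsUniform (ω x) (Set.Ico 0 (2 * Real.pi)) P volume) →
        ∀ C ∈ Matrix.unitaryGroup (Fin 3) ℂ, HexWalk.maxNorm (C - HexWalk.C₀) ≤ φ →
        ∀ z : ℂ, ‖z‖ < 1 →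
          (∀ a : Ω, IsUnit (HexWalk.walk (fun x => ω x a) C - z • (1 : HexWalk.H →L[ℂ] HexWalk.H))) ∧
          ∀ (x y : HexWalk.Site) (i j : Fin 3),
            Integrable (fun a => ‖HexWalk.green (fun v => ω v a) C z x i y j‖ ^ s) P ∧
            ∫ a, ‖HexWalk.green (fun v => ω v a) C z x i y j‖ ^ s ∂P
              ≤ c * Real.exp (-g * (HexWalk.graph.dist x y : ℝ)) := by
  obtain ⟨φ, hφ, c, hc, g, hg, h⟩ := HexWalk.exists_lintegral_res_le_exp hs0 hs1
  refine ⟨φ, hφ, c, hc, g, hg, fun Ω _ P _ ω hm hind hunif C hC hCφ z hz =>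
    ⟨fun a => HexWalk.isUnit_walk_sub _ hC hz, fun x y i j => ?_⟩⟩
  -- `pdf.IsUniform` unfolds to equality of the law with the conditioned Lebesgue measure
  -- `uniformAngle`.
  have hω : HexWalk.IIDPhases P ω := ⟨hm, hind, hunif⟩
  have hbound := h Ω P ω hω C hC hCφ z hz (x, i) (y, j)
  simp only [HexWalk.norm_green _ hC hz]
  have hωm : Measurable fun o x => ω x o := measurable_pi_iff.2 hm
  have hmeas : Measurable fun a =>
      ‖HexWalk.res C z (HexWalk.phases fun v => ω v a) (x, i) (y, j)‖ ^ s :=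
    ((HexWalk.measurable_res_phases hC hz _ _).comp hωm).norm.pow_const s
  have heq : ∀ a, ENNReal.ofReal
      (‖HexWalk.res C z (HexWalk.phases fun v => ω v a) (x, i) (y, j)‖ ^ s)
      = ‖HexWalk.res C z (HexWalk.phases fun v => ω v a) (x, i) (y, j)‖ₑ ^ s := by
    intro a
    rw [← ENNReal.ofReal_rpow_of_nonneg (norm_nonneg _) hs0.le, ofReal_norm]
  have hnonneg : ∀ a, 0 ≤ ‖HexWalk.res C z (HexWalk.phases fun v => ω v a) (x, i) (y, j)‖ ^ s :=
    fun a => by positivity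
  constructor
  · refine ⟨hmeas.aestronglyMeasurable, ?_⟩
    rw [hasFiniteIntegral_iff_ofReal (Filter.Eventually.of_forall hnonneg)]
    simp only [heq]
    exact hbound.trans_lt ENNReal.ofReal_lt_top
  · rw [integral_eq_lintegral_of_nonneg_ae (Filter.Eventually.of_forall hnonneg)
      hmeas.aestronglyMeasurable]
    simp only [heq]
    exact ENNReal.toReal_le_of_le_ofReal (by positivity) hbound
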